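/- **The calculus $\mathsf{CC}_{<:\Box}$.** All expressions are taken up to renaming of bound variables. Let $x,y,z$ range over term variables and $X,Y,Z$ over type variables. *Syntax.* - Capture sets $C, D$: finite sets of term variables, which may also contain a special symbol $*$ that is never bound. - Shape types: $S ::= X \mid \top \mid \forall(x:U)T \mid \forall[X<:S]T \mid \Box\,T$. - Types: $T,U ::= S \mid C\,S$, where $S$ is identified with $\{\}\,S$, so that every type is of the form $C\,S$. - Values: $v ::= \lambda(x:T)t \mid \lambda[X<:S]t \mid \Box\,x$. - Terms: $s,t ::= v \mid x \mid x\,y \mid x\,[S] \mid \mathbf{let}\ x=s\ \mathbf{in}\ t \mid C\multimap x$ (unboxing). - Environments: $\Gamma ::= \cdot \mid \Gamma,x:T \mid \Gamma,X<:S$, with pairwise distinct bound variables; $\mathrm{dom}(\Gamma)$ denotes the variables bound in $\Gamma$. *Captured variables.* $\mathrm{cv}(\lambda(x:T)t)=\mathrm{cv}(t)\setminus\{x\}$; $\mathrm{cv}(\lambda[X<:S]t)=\mathrm{cv}(t)$; $\mathrm{cv}(x)=\mathrm{cv}(x[S])=\{x\}$; $\mathrm{cv}(x\,y)=\{x,y\}$;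 $\mathrm{cv}(\Box\,x)=\{\}$; $\mathrm{cv}(C\multimap x)=C\cup\{x\}$; $\mathrm{cv}(\mathbf{let}\ x=s\ \mathbf{in}\ t)$ is $\mathrm{cv}(t)$ if $s$ is a value and $x\notin\mathrm{cv}(t)$, and $\mathrm{cv}(s)\cup(\mathrm{cv}(t)\setminus\{x\})$ otherwise. *Well-formedness.* $\Gamma\vdash T\ \mathbf{wf}$ means that every free type variable of $T$ is bound in $\Gamma$ and that every element of a capture set in $T$ is $*$ or a term variable in scope (bound in $\Gamma$ or by an enclosing binder in $T$). $\vdash\Gamma\ \mathbf{wf}$ means that each type or bound in $\Gamma$ is well-formed in the part of $\Gamma$ preceding it. *Subcapturing* $\Gamma\vdash C<:D$ is generated by: - $\Gamma\vdash\{x\}<:C$ if $x\in C$ (also for $x=*$); - $\Gamma\vdash\{x_1,\dots,x_n\}<:C$ if $\Gamma\vdash\{x_i\}<:C$ for all $i$ (also for $x_i=*$); - $\Gamma\vdash\{x\}<:C$ if $x:C'\,S\in\Gamma$ and $\Gamma\vdash C'<:C$. *Subtyping* $\Gamma\vdash T<:U$ is the reflexive and transitive relation generated by: - $\Gamma\vdash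 X<:S$ if $X<:S\in\Gamma$; and $\Gamma\vdash S<:\top$; - $\Gamma\vdash\forall(x:U_1)T_1<:\forall(x:U_2)T_2$ if $\Gamma\vdash U_2<:U_1$ and $\Gamma,x:U_2\vdash T_1<:T_2$; - $\Gamma\vdash\forall[X<:S_1]T_1<:\forall[X<:S_2]T_2$ if $\Gamma\vdash S_2<:S_1$ and $\Gamma,X<:S_2\vdash T_1<:T_2$; - $\Gamma\vdash C_1\,S_1<:C_2\,S_2$ if $\Gamma\vdash C_1<:C_2$ and $\Gamma\vdash S_1<:S_2$; - $\Gamma\vdash\Box\,T_1<:\Box\,T_2$ if $\Gamma\vdash T_1<:T_2$. *Typing* $\Gamma\vdash t:T$ is generated by: - $\Gamma\vdash x:\{x\}\,S$ if $x:C\,S\in\Gamma$; - $\Gamma\vdash t:U$ if $\Gamma\vdash t:T$, $\Gamma\vdash T<:U$ and $\Gamma\vdash U\ \mathbf{wf}$; - $\Gamma\vdash\lambda(x:U)t:(\mathrm{cv}(t)\setminus\{x\})\,\forall(x:U)T$ if $\Gamma,x:U\vdash t:T$ and $\Gamma\vdash U\ \mathbf{wf}$; - $\Gamma\vdash\lambda[X<:S]t:\mathrm{cv}(t)\,\forall[X<:S]T$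 if $\Gamma,X<:S\vdash t:T$ and $\Gamma\vdash S\ \mathbf{wf}$; - $\Gamma\vdash x\,y:[z:=y]T$ if $\Gamma\vdash x:C\,\forall(z:U)T$ and $\Gamma\vdash y:U$; - $\Gamma\vdash x\,[S]:[X:=S]T$ if $\Gamma\vdash x:C\,\forall[X<:S]T$; - $\Gamma\vdash\Box\,x:\Box\,C\,S$ if $\Gamma\vdash x:C\,S$ and $C\subseteq\mathrm{dom}(\Gamma)$; - $\Gamma\vdash C\multimap x:C\,S$ if $\Gamma\vdash x:\Box\,C\,S$ and $C\subseteq\mathrm{dom}(\Gamma)$; - $\Gamma\vdash\mathbf{let}\ x=s\ \mathbf{in}\ t:U$ if $\Gamma\vdash s:T$, $\Gamma,x:T\vdash t:U$ and $x\notin\mathrm{fv}(U)$. *Evaluation.* Store contexts are $\sigma::=[\,]\mid\mathbf{let}\ x=v\ \mathbf{in}\ \sigma$ and evaluation contexts are $e::=[\,]\mid\mathbf{let}\ x=e\ \mathbf{in}\ t$; $\sigma[t]$ and $e[t]$ denote filling the hole, where $t$ may use the variables bound by $\sigma$, and $\sigma(x)$ is the value bound to $x$ in $\sigma$. Reduction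 $\longrightarrow$ of terms is given by: - $\sigma[e[x\,y]]\longrightarrow\sigma[e[[z:=y]t]]$ if $\sigma(x)=\lambda(z:T)t$; - $\sigma[e[x\,[S]]]\longrightarrow\sigma[e[[X:=S]t]]$ if $\sigma(x)=\lambda[X<:S']t$; - $\sigma[e[C\multimap x]]\longrightarrow\sigma[e[y]]$ if $\sigma(x)=\Box\,y$; - $\sigma[e[\mathbf{let}\ x=y\ \mathbf{in}\ t]]\longrightarrow\sigma[e[[x:=y]t]]$; - $\sigma[e[\mathbf{let}\ x=v\ \mathbf{in}\ t]]\longrightarrow\sigma[\mathbf{let}\ x=v\ \mathbf{in}\ e[t]]$ if $e\neq[\,]$ (with $x$ not free in $e$). *Matching environments.* $\Gamma\vdash\sigma\sim\Delta$ is generated by: $\Gamma\vdash[\,]\sim\cdot$; and $\Gamma\vdash(\mathbf{let}\ x=v\ \mathbf{in}\ \sigma)\sim(x:T,\Delta)$ if $\Gamma,x:T\vdash\sigma\sim\Delta$, $\Gamma\vdash v:T$ and $x\notin\mathrm{fv}(T)$. **Theorem (Preservation).** Let $\Gamma$ be a well-formed environment, $\sigma$ a store context, $\Delta$ an environment, $t,t'$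 terms and $T$ a type. If $\Gamma\vdash\sigma\sim\Delta$, $\Gamma,\Delta\vdash t:T$ and $\sigma[t]\longrightarrow\sigma[t']$, then $\Gamma,\Delta\vdash t':T$. -/

import Mathlib

/-!
The calculus of capturing types with boxes.

Terms and types are considered up to renaming of bound variables, which is realised by de Bruijn
indices.  Term variables and type variables live in two separate index spaces: a term binder
(`λ(x : U)`, `∀(x : U)`, `let x = _ in`) binds the term index `0`, a type binder
(`λ[X <: S]`, `∀[X <: S]`) binds the type index `0`.
Expressions are raw: scoping is imposed by the well-formedness judgements and by typing.
-/

namespace CC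

/-! ## Capture sets -/

/-- The elements of capture sets: term variables and the universal capability `*`. -/
inductive Cap : Type
  | star : Cap
  | var : ℕ → Cap
  deriving DecidableEq

/-- Capture sets are finite sets of variables, possibly containing `*`. -/
abbrev CaptureSet : Type := Finset Cap

/-- Renaming of term variables; `*` is fixed. -/
def Cap.rename (f : ℕ → ℕ) : Cap → Cap
  | .star => .star
  | .var i => .var (f i)

def CaptureSet.rename (f : ℕ → ℕ) (C : CaptureSet) : CaptureSet :=
  C.image (Cap.rename f)

/-- `C \ x` for the innermost bound variable `x`, seen outside the scope of `x`. -/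
def CaptureSet.unbind (C : CaptureSet) : CaptureSet :=
  (C.erase (.var 0)).image (Cap.rename Nat.pred)

/-- The action of a renaming under one more binder. -/
def lift (f : ℕ → ℕ) : ℕ → ℕ
  | 0 => 0
  | i + 1 => f i + 1

/-- The renaming that replaces the innermost variable by `y`. -/
def instVar (y : ℕ) : ℕ → ℕ
  | 0 => y
  | i + 1 => i

/-! ## Types -/

mutual
  /-- Shape types `S ::= X | ⊤ | ∀(x : U) T | ∀[X <: S] T | □ T`. -/
  inductive Shape : Type
    | tvar : ℕ → Shape
    | top : Shape
    | all : Ty → Ty → Shape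
    | tall : Shape → Ty → Shape
    | box : Ty → Shape
  /-- Types `C S`.  The identification of a shape type `S` with `{} S` is built in: a shape type
  used as a type is `Ty.capt ∅ S`. -/
  inductive Ty : Type
    | capt : CaptureSet → Shape → Ty
end

/-- The shape type `S`, used as a type. -/
abbrev Shape.toTy (S : Shape) : Ty := Ty.capt ∅ S

mutual
  /-- Renaming of term variables by `f` and of type variables by `g`. -/
  def Shape.rename (f g : ℕ → ℕ) : Shape → Shape
    | .tvar X => .tvar (g X)
    | .top => .top
    | .all U T => .all (Ty.rename f g U) (Ty.rename (lift f) g T)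
    | .tall S T => .tall (Shape.rename f g S) (Ty.rename f (lift g) T)
    | .box T => .box (Ty.rename f g T)
  def Ty.rename (f g : ℕ → ℕ) : Ty → Ty
    | .capt C S => .capt (CaptureSet.rename f C) (Shape.rename f g S)
end

/-- A simultaneous substitution of shape types for type variables, under a term binder. -/
def liftSubstVar (τ : ℕ → Shape) : ℕ → Shape :=
  fun X => (τ X).rename Nat.succ id

/-- A simultaneous substitution of shape types for type variables, under a type binder. -/
def liftSubstTVar (τ : ℕ → Shape) : ℕ → Shape
  | 0 => .tvar 0
  | X + 1 => (τ X).rename id Nat.succ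

/-- The substitution that replaces the innermost type variable by `S`. -/
def instTVar (S : Shape) : ℕ → Shape
  | 0 => S
  | X + 1 => .tvar X

mutual
  /-- Simultaneous substitution of shape types for type variables. -/
  def Shape.tsubst (τ : ℕ → Shape) : Shape → Shape
    | .tvar X => τ X
    | .top => .top
    | .all U T => .all (Ty.tsubst τ U) (Ty.tsubst (liftSubstVar τ) T)
    | .tall S T => .tall (Shape.tsubst τ S) (Ty.tsubst (liftSubstTVar τ) T)
    | .box T => .box (Ty.tsubst τ T)
  def Ty.tsubst (τ : ℕ → Shape) : Ty → Ty
    | .capt C S => .capt C (Shape.tsubst τ S)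
end

/-- Weakening of a type by one term variable. -/
abbrev Ty.shiftVar (T : Ty) : Ty := T.rename Nat.succ id

/-- Weakening of a type by one type variable. -/
abbrev Ty.shiftTVar (T : Ty) : Ty := T.rename id Nat.succ

abbrev Shape.shiftVar (S : Shape) : Shape := S.rename Nat.succ id

abbrev Shape.shiftTVar (S : Shape) : Shape := S.rename id Nat.succ

/-- `[z := y] T` for the innermost term variable `z`. -/
def Ty.inst (T : Ty) (y : ℕ) : Ty := T.rename (instVar y) id

/-- `[X := S] T` for the innermost type variable `X`. -/
def Ty.tinst (T : Ty) (S : Shape) : Ty := T.tsubst (instTVar S)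

/-! ## Terms -/

/-- Terms, in monadic normal form. -/
inductive Term : Type
  /-- `x` -/
  | var : ℕ → Term
  /-- `λ(x : U) t` -/
  | abs : Ty → Term → Term
  /-- `λ[X <: S] t` -/
  | tabs : Shape → Term → Term
  /-- `□ x` -/
  | box : ℕ → Term
  /-- `x y` -/
  | app : ℕ → ℕ → Term
  /-- `x [S]` -/
  | tapp : ℕ → Shape → Term
  /-- `let x = s in t` -/
  | letIn : Term → Term → Term
  /-- `C ⟜ x` -/
  | unbox : CaptureSet → ℕ → Term

/-- Values are the abstractions, the type abstractions and the boxed variables. -/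
def Term.isValue : Term → Bool
  | .abs _ _ => true
  | .tabs _ _ => true
  | .box _ => true
  | _ => false

/-- Renaming of term variables by `f` and of type variables by `g`. -/
def Term.rename (f g : ℕ → ℕ) : Term → Term
  | .var x => .var (f x)
  | .abs U t => .abs (U.rename f g) (t.rename (lift f) g)
  | .tabs S t => .tabs (S.rename f g) (t.rename f (lift g))
  | .box x => .box (f x)
  | .app x y => .app (f x) (f y)
  | .tapp x S => .tapp (f x) (S.rename f g)
  | .letIn s t => .letIn (s.rename f g) (t.rename (lift f) g)
  | .unbox C x => .unbox (CaptureSet.rename f C) (f x)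

/-- Simultaneous substitution of shape types for type variables. -/
def Term.tsubst (τ : ℕ → Shape) : Term → Term
  | .var x => .var x
  | .abs U t => .abs (U.tsubst τ) (t.tsubst (liftSubstVar τ))
  | .tabs S t => .tabs (S.tsubst τ) (t.tsubst (liftSubstTVar τ))
  | .box x => .box x
  | .app x y => .app x y
  | .tapp x S => .tapp x (S.tsubst τ)
  | .letIn s t => .letIn (s.tsubst τ) (t.tsubst (liftSubstVar τ))
  | .unbox C x => .unbox C x

/-- `[z := y] t` for the innermost term variable `z`. -/
def Term.inst (t : Term) (y : ℕ) : Term := t.rename (instVar y) id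

/-- `[X := S] t` for the innermost type variable `X`. -/
def Term.tinst (t : Term) (S : Shape) : Term := t.tsubst (instTVar S)

/-- The captured variables of a term.  In `let x = v in t` with a value `v`, the captured
variables of `v` are counted only if `x` is captured by `t`. -/
def Term.cv : Term → CaptureSet
  | .var x => {.var x}
  | .abs _ t => CaptureSet.unbind t.cv
  | .tabs _ t => t.cv
  | .box _ => ∅
  | .app x y => {.var x, .var y}
  | .tapp x _ => {.var x}
  | .letIn s t =>
      if s.isValue = true ∧ Cap.var 0 ∉ t.cv then CaptureSet.unbind t.cv
      else s.cv ∪ CaptureSet.unbind t.cv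
  | .unbox C x => C ∪ {.var x}

/-! ## Typing environments -/

/-- Typing environments `Γ ::= · | Γ, x : T | Γ, X <: S`. -/
inductive Ctx : Type
  | nil : Ctx
  | var : Ctx → Ty → Ctx
  | tvar : Ctx → Shape → Ctx

/-- `x : T ∈ Γ`, with `T` weakened to the scope of the whole of `Γ`. -/
inductive Ctx.HasVar : Ctx → ℕ → Ty → Prop
  | here {Γ : Ctx} {T : Ty} : Ctx.HasVar (Γ.var T) 0 T.shiftVar
  | var {Γ : Ctx} {x : ℕ} {T U : Ty} :
      Ctx.HasVar Γ x T → Ctx.HasVar (Γ.var U) (x + 1) T.shiftVar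
  | tvar {Γ : Ctx} {x : ℕ} {T : Ty} {S : Shape} :
      Ctx.HasVar Γ x T → Ctx.HasVar (Γ.tvar S) x T.shiftTVar

/-- `X <: S ∈ Γ`, with `S` weakened to the scope of the whole of `Γ`. -/
inductive Ctx.HasTVar : Ctx → ℕ → Shape → Prop
  | here {Γ : Ctx} {S : Shape} : Ctx.HasTVar (Γ.tvar S) 0 S.shiftTVar
  | var {Γ : Ctx} {X : ℕ} {S : Shape} {U : Ty} :
      Ctx.HasTVar Γ X S → Ctx.HasTVar (Γ.var U) X S.shiftVar
  | tvar {Γ : Ctx} {X : ℕ} {S R : Shape} :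
      Ctx.HasTVar Γ X S → Ctx.HasTVar (Γ.tvar R) (X + 1) S.shiftTVar

/-- The term variables bound in `Γ`; `*` is never among them. -/
def Ctx.dom (Γ : Ctx) : Set Cap := {c | ∃ (x : ℕ) (T : Ty), c = .var x ∧ Γ.HasVar x T}

/-- `Γ, Δ` for a sequence `Δ = x₁ : T₁, …, xₙ : Tₙ` of term bindings, outermost binding first. -/
def Ctx.append : Ctx → List Ty → Ctx
  | Γ, [] => Γ
  | Γ, T :: Δ => Ctx.append (Γ.var T) Δ

/-! ## Well-formedness -/

mutual
  /-- `Γ ⊢ S wf` -/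
  inductive Shape.WF : Ctx → Shape → Prop
    | tvar {Γ : Ctx} {X : ℕ} {S : Shape} : Γ.HasTVar X S → Shape.WF Γ (.tvar X)
    | top {Γ : Ctx} : Shape.WF Γ .top
    | all {Γ : Ctx} {U T : Ty} : Ty.WF Γ U → Ty.WF (Γ.var U) T → Shape.WF Γ (.all U T)
    | tall {Γ : Ctx} {S : Shape} {T : Ty} :
        Shape.WF Γ S → Ty.WF (Γ.tvar S) T → Shape.WF Γ (.tall S T)
    | box {Γ : Ctx} {T : Ty} : Ty.WF Γ T → Shape.WF Γ (.box T)
  /-- `Γ ⊢ T wf` -/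
  inductive Ty.WF : Ctx → Ty → Prop
    | capt {Γ : Ctx} {C : CaptureSet} {S : Shape} :
        Shape.WF Γ S → (C : Set Cap) ⊆ Γ.dom ∪ {Cap.star} → Ty.WF Γ (.capt C S)
end

/-- `⊢ Γ wf` -/
inductive Ctx.WF : Ctx → Prop
  | nil : Ctx.WF .nil
  | var {Γ : Ctx} {T : Ty} : Ctx.WF Γ → Ty.WF Γ T → Ctx.WF (Γ.var T)
  | tvar {Γ : Ctx} {S : Shape} : Ctx.WF Γ → Shape.WF Γ S → Ctx.WF (Γ.tvar S)

/-! ## Subcapturing, subtyping, typing -/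

/-- Subcapturing `Γ ⊢ C <: D` -/
inductive Subcapt : Ctx → CaptureSet → CaptureSet → Prop
  | sc_elem {Γ : Ctx} {c : Cap} {C : CaptureSet} : c ∈ C → Subcapt Γ {c} C
  | sc_set {Γ : Ctx} {C D : CaptureSet} : (∀ c ∈ C, Subcapt Γ {c} D) → Subcapt Γ C D
  | sc_var {Γ : Ctx} {x : ℕ} {C D : CaptureSet} {S : Shape} :
      Γ.HasVar x (.capt C S) → Subcapt Γ C D → Subcapt Γ {.var x} D

/-- Subtyping `Γ ⊢ T <: U` -/
inductive Subtyp : Ctx → Ty → Ty → Prop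
  | refl {Γ : Ctx} {T : Ty} : Subtyp Γ T T
  | trans {Γ : Ctx} {T₁ T₂ T₃ : Ty} : Subtyp Γ T₁ T₂ → Subtyp Γ T₂ T₃ → Subtyp Γ T₁ T₃
  | tvar {Γ : Ctx} {X : ℕ} {S : Shape} :
      Γ.HasTVar X S → Subtyp Γ (Shape.tvar X).toTy S.toTy
  | top {Γ : Ctx} {S : Shape} : Subtyp Γ S.toTy Shape.top.toTy
  | fn {Γ : Ctx} {U₁ U₂ T₁ T₂ : Ty} :
      Subtyp Γ U₂ U₁ → Subtyp (Γ.var U₂) T₁ T₂ →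
      Subtyp Γ (Shape.all U₁ T₁).toTy (Shape.all U₂ T₂).toTy
  | tfn {Γ : Ctx} {S₁ S₂ : Shape} {T₁ T₂ : Ty} :
      Subtyp Γ S₂.toTy S₁.toTy → Subtyp (Γ.tvar S₂) T₁ T₂ →
      Subtyp Γ (Shape.tall S₁ T₁).toTy (Shape.tall S₂ T₂).toTy
  | capt {Γ : Ctx} {C₁ C₂ : CaptureSet} {S₁ S₂ : Shape} :
      Subcapt Γ C₁ C₂ → Subtyp Γ S₁.toTy S₂.toTy → Subtyp Γ (.capt C₁ S₁) (.capt C₂ S₂)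
  | boxed {Γ : Ctx} {T₁ T₂ : Ty} :
      Subtyp Γ T₁ T₂ → Subtyp Γ (Shape.box T₁).toTy (Shape.box T₂).toTy

/-- Typing `Γ ⊢ t : T` -/
inductive HasType : Ctx → Term → Ty → Prop
  | var {Γ : Ctx} {x : ℕ} {C : CaptureSet} {S : Shape} :
      Γ.HasVar x (.capt C S) → HasType Γ (.var x) (.capt {.var x} S)
  | sub {Γ : Ctx} {t : Term} {T U : Ty} :
      HasType Γ t T → Subtyp Γ T U → Ty.WF Γ U → HasType Γ t U
  | abs {Γ : Ctx} {U T : Ty} {t : Term} :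
      HasType (Γ.var U) t T → Ty.WF Γ U →
      HasType Γ (.abs U t) (.capt (CaptureSet.unbind t.cv) (.all U T))
  | tabs {Γ : Ctx} {S : Shape} {T : Ty} {t : Term} :
      HasType (Γ.tvar S) t T → Shape.WF Γ S →
      HasType Γ (.tabs S t) (.capt t.cv (.tall S T))
  | app {Γ : Ctx} {x y : ℕ} {C : CaptureSet} {U T : Ty} :
      HasType Γ (.var x) (.capt C (.all U T)) → HasType Γ (.var y) U →
      HasType Γ (.app x y) (T.inst y)
  | tapp {Γ : Ctx} {x : ℕ} {C : CaptureSet} {S : Shape} {T : Ty} :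
      HasType Γ (.var x) (.capt C (.tall S T)) → HasType Γ (.tapp x S) (T.tinst S)
  | box {Γ : Ctx} {x : ℕ} {C : CaptureSet} {S : Shape} :
      HasType Γ (.var x) (.capt C S) → (C : Set Cap) ⊆ Γ.dom →
      HasType Γ (.box x) (Shape.box (.capt C S)).toTy
  | unbox {Γ : Ctx} {x : ℕ} {C : CaptureSet} {S : Shape} :
      HasType Γ (.var x) (Shape.box (.capt C S)).toTy → (C : Set Cap) ⊆ Γ.dom →
      HasType Γ (.unbox C x) (.capt C S)
  /-- The side condition `x ∉ fv(U)` is expressed by typing the body with a weakened type. -/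
  | letIn {Γ : Ctx} {s t : Term} {T U : Ty} :
      HasType Γ s T → HasType (Γ.var T) t U.shiftVar → HasType Γ (.letIn s t) U

/-! ## Evaluation -/

/-- Store contexts `σ ::= [] | let x = v in σ`. -/
inductive Store : Type
  | hole : Store
  | letIn (v : Term) (hv : v.isValue = true) (σ : Store) : Store

/-- `σ[t]`; the variables bound by `σ` are in scope in `t`. -/
def Store.plug : Store → Term → Term
  | .hole, t => t
  | .letIn v _ σ, t => .letIn v (σ.plug t)

/-- The number of variables bound by a store context. -/
def Store.size : Store → ℕ
  | .hole => 0
  | .letIn _ _ σ => σ.size + 1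

/-- `σ(x) = v`, where `x` and `v` are taken in the scope of the hole of `σ`. -/
inductive Store.Lookup : Store → ℕ → Term → Prop
  | here {v : Term} {hv : v.isValue = true} {σ : Store} :
      Store.Lookup (.letIn v hv σ) σ.size (v.rename (· + (σ.size + 1)) id)
  | there {w : Term} {hw : w.isValue = true} {σ : Store} {x : ℕ} {v : Term} :
      Store.Lookup σ x v → Store.Lookup (.letIn w hw σ) x v

/-- Evaluation contexts `e ::= [] | let x = e in t`. -/
inductive ECtx : Type
  | hole : ECtx
  | letIn : ECtx → Term → ECtx

/-- `e[s]` -/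
def ECtx.plug : ECtx → Term → Term
  | .hole, s => s
  | .letIn e t, s => .letIn (e.plug s) t

/-- Weakening of an evaluation context by one term variable. -/
def ECtx.shiftVar : ECtx → ECtx
  | .hole => .hole
  | .letIn e t => .letIn e.shiftVar (t.rename (lift Nat.succ) id)

/-- Small-step reduction of (whole) terms. -/
inductive Step : Term → Term → Prop
  | apply {σ : Store} {e : ECtx} {x y : ℕ} {U : Ty} {t : Term} :
      σ.Lookup x (.abs U t) →
      Step (σ.plug (e.plug (.app x y))) (σ.plug (e.plug (t.inst y)))
  | tapply {σ : Store} {e : ECtx} {x : ℕ} {S S' : Shape} {t : Term} :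
      σ.Lookup x (.tabs S' t) →
      Step (σ.plug (e.plug (.tapp x S))) (σ.plug (e.plug (t.tinst S)))
  | open {σ : Store} {e : ECtx} {C : CaptureSet} {x y : ℕ} :
      σ.Lookup x (.box y) →
      Step (σ.plug (e.plug (.unbox C x))) (σ.plug (e.plug (.var y)))
  | rename {σ : Store} {e : ECtx} {y : ℕ} {t : Term} :
      Step (σ.plug (e.plug (.letIn (.var y) t))) (σ.plug (e.plug (t.inst y)))
  | lift {σ : Store} {e : ECtx} {v t : Term} :
      v.isValue = true → e ≠ .hole →
      Step (σ.plug (e.plug (.letIn v t))) (σ.plug (.letIn v (e.shiftVar.plug t)))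

/-! ## Matching environments -/

/-- `Γ ⊢ σ ∼ Δ`.  The type `T` lives in the scope of `Γ`, so that it cannot mention the variable
bound by the `let`. -/
inductive Matches : Ctx → Store → List Ty → Prop
  | hole {Γ : Ctx} : Matches Γ .hole []
  | letIn {Γ : Ctx} {v : Term} {hv : v.isValue = true} {σ : Store} {T : Ty} {Δ : List Ty} :
      Matches (Γ.var T) σ Δ → HasType Γ v T → Matches Γ (.letIn v hv σ) (T :: Δ)

end CC

namespace CC

/-! ## Capture sets under renaming -/

theorem CaptureSet.mem_rename {f : ℕ → ℕ} {C : CaptureSet} {c : Cap} :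
    c ∈ CaptureSet.rename f C ↔ ∃ d ∈ C, Cap.rename f d = c := by
  simp [CaptureSet.rename]

theorem Cap.rename_comp (f g : ℕ → ℕ) (c : Cap) :
    (c.rename f).rename g = c.rename (g ∘ f) := by cases c <;> rfl

theorem Cap.rename_id (c : Cap) : c.rename id = c := by cases c <;> rfl

theorem CaptureSet.rename_comp (f g : ℕ → ℕ) (C : CaptureSet) :
    CaptureSet.rename g (CaptureSet.rename f C) = CaptureSet.rename (g ∘ f) C := by
  simp only [CaptureSet.rename, Finset.image_image]
  congr 1
  funext c
  exact Cap.rename_comp f g c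

theorem CaptureSet.rename_id (C : CaptureSet) : CaptureSet.rename id C = C := by
  simp only [CaptureSet.rename]
  rw [show Cap.rename id = id from funext Cap.rename_id, Finset.image_id]

theorem CaptureSet.rename_singleton (f : ℕ → ℕ) (c : Cap) :
    CaptureSet.rename f {c} = {c.rename f} := by
  simp [CaptureSet.rename]

theorem CaptureSet.rename_union (f : ℕ → ℕ) (C D : CaptureSet) :
    CaptureSet.rename f (C ∪ D) = CaptureSet.rename f C ∪ CaptureSet.rename f D :=
  Finset.image_union _ _

theorem CaptureSet.mem_unbind_star {C : CaptureSet} : Cap.star ∈ C.unbind ↔ Cap.star ∈ C := by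
  simp only [CaptureSet.unbind, Finset.mem_image, Finset.mem_erase]
  constructor
  · rintro ⟨(_ | _), ⟨_, h⟩, e⟩
    · exact h
    · cases e
  · intro h
    exact ⟨.star, ⟨by simp, h⟩, rfl⟩

theorem CaptureSet.mem_unbind_var {C : CaptureSet} {x : ℕ} :
    Cap.var x ∈ C.unbind ↔ Cap.var (x + 1) ∈ C := by
  simp only [CaptureSet.unbind, Finset.mem_image, Finset.mem_erase]
  constructor
  · rintro ⟨(_ | _ | i), ⟨hn, h⟩, e⟩
    · cases e
    · exact absurd rfl hn
    · cases e
      exact h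
  · intro h
    exact ⟨.var (x + 1), ⟨by simp, h⟩, rfl⟩

theorem CaptureSet.zero_mem_rename_lift {f : ℕ → ℕ} {C : CaptureSet} :
    Cap.var 0 ∈ CaptureSet.rename (lift f) C ↔ Cap.var 0 ∈ C := by
  rw [CaptureSet.mem_rename]
  constructor
  · rintro ⟨(_ | _ | i), h, e⟩
    · cases e
    · exact h
    · cases e
  · intro h
    exact ⟨_, h, rfl⟩

theorem CaptureSet.unbind_rename_lift (f : ℕ → ℕ) (C : CaptureSet) :
    CaptureSet.unbind (CaptureSet.rename (lift f) C) = CaptureSet.rename f (CaptureSet.unbind C) := by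
  ext (_ | y)
  · rw [CaptureSet.mem_unbind_star, CaptureSet.mem_rename, CaptureSet.mem_rename]
    constructor
    · rintro ⟨(_ | _), h, e⟩
      · exact ⟨.star, CaptureSet.mem_unbind_star.2 h, rfl⟩
      · cases e
    · rintro ⟨(_ | _), h, e⟩
      · exact ⟨.star, CaptureSet.mem_unbind_star.1 h, rfl⟩
      · cases e
  · rw [CaptureSet.mem_unbind_var, CaptureSet.mem_rename, CaptureSet.mem_rename]
    constructor
    · rintro ⟨(_ | _ | i), h, e⟩
      · cases e
      · cases e
      · cases e
        exact ⟨.var i, CaptureSet.mem_unbind_var.2 h, rfl⟩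
    · rintro ⟨(_ | i), h, e⟩
      · cases e
      · cases e
        exact ⟨.var (i + 1), CaptureSet.mem_unbind_var.1 h, rfl⟩

/-! ## Simultaneous substitution -/

theorem lift_id : lift id = id := by
  funext i
  cases i <;> rfl

theorem lift_comp (f g : ℕ → ℕ) : lift g ∘ lift f = lift (g ∘ f) := by
  funext i
  cases i <;> rfl

theorem lift_comp_succ (f : ℕ → ℕ) : lift f ∘ Nat.succ = Nat.succ ∘ f := rfl

mutual
  /-- Renaming of term variables by `f`, with substitution of shape types for type variables. -/
  def Shape.sub (f : ℕ → ℕ) (τ : ℕ → Shape) : Shape → Shape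
    | .tvar X => τ X
    | .top => .top
    | .all U T => .all (Ty.sub f τ U) (Ty.sub (lift f) (liftSubstVar τ) T)
    | .tall S T => .tall (Shape.sub f τ S) (Ty.sub f (liftSubstTVar τ) T)
    | .box T => .box (Ty.sub f τ T)
  /-- Renaming of term variables by `f`, with substitution of shape types for type variables. -/
  def Ty.sub (f : ℕ → ℕ) (τ : ℕ → Shape) : Ty → Ty
    | .capt C S => .capt (CaptureSet.rename f C) (Shape.sub f τ S)
end

/-- Renaming of term variables by `f`, with substitution of shape types for type variables. -/
def Term.sub (f : ℕ → ℕ) (τ : ℕ → Shape) : Term → Term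
  | .var x => .var (f x)
  | .abs U t => .abs (U.sub f τ) (t.sub (lift f) (liftSubstVar τ))
  | .tabs S t => .tabs (S.sub f τ) (t.sub f (liftSubstTVar τ))
  | .box x => .box (f x)
  | .app x y => .app (f x) (f y)
  | .tapp x S => .tapp (f x) (S.sub f τ)
  | .letIn s t => .letIn (s.sub f τ) (t.sub (lift f) (liftSubstVar τ))
  | .unbox C x => .unbox (CaptureSet.rename f C) (f x)

theorem liftSubstVar_tvar (g : ℕ → ℕ) :
    liftSubstVar (fun X => .tvar (g X)) = fun X => .tvar (g X) := by
  funext X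
  simp [liftSubstVar, Shape.rename]

theorem liftSubstTVar_tvar (g : ℕ → ℕ) :
    liftSubstTVar (fun X => .tvar (g X)) = fun X => .tvar (lift g X) := by
  funext X
  cases X <;> simp [liftSubstTVar, Shape.rename, lift]

mutual
  theorem Shape.rename_eq_sub (f g : ℕ → ℕ) :
      (S : Shape) → S.rename f g = S.sub f (fun X => .tvar (g X))
    | .tvar X => by simp only [Shape.rename, Shape.sub]
    | .top => by simp only [Shape.rename, Shape.sub]
    | .all U T => by
        simp only [Shape.rename, Shape.sub, liftSubstVar_tvar, Ty.rename_eq_sub f g U,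
          Ty.rename_eq_sub (lift f) g T]
    | .tall S T => by
        simp only [Shape.rename, Shape.sub, liftSubstTVar_tvar, Shape.rename_eq_sub f g S,
          Ty.rename_eq_sub f (lift g) T]
    | .box T => by simp only [Shape.rename, Shape.sub, Ty.rename_eq_sub f g T]
  theorem Ty.rename_eq_sub (f g : ℕ → ℕ) :
      (T : Ty) → T.rename f g = T.sub f (fun X => .tvar (g X))
    | .capt C S => by simp only [Ty.rename, Ty.sub, Shape.rename_eq_sub f g S]
end

theorem Term.rename_eq_sub (t : Term) : ∀ f g : ℕ → ℕ,
    t.rename f g = t.sub f (fun X => .tvar (g X)) := by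
  induction t <;> intro f g <;>
    simp_all [Term.rename, Term.sub, liftSubstVar_tvar, liftSubstTVar_tvar, Ty.rename_eq_sub,
      Shape.rename_eq_sub]

mutual
  theorem Shape.tsubst_eq_sub (τ : ℕ → Shape) : (S : Shape) → S.tsubst τ = S.sub id τ
    | .tvar X => by simp only [Shape.tsubst, Shape.sub]
    | .top => by simp only [Shape.tsubst, Shape.sub]
    | .all U T => by
        simp only [Shape.tsubst, Shape.sub, lift_id, Ty.tsubst_eq_sub τ U,
          Ty.tsubst_eq_sub (liftSubstVar τ) T]
    | .tall S T => by
        simp only [Shape.tsubst, Shape.sub, Shape.tsubst_eq_sub τ S,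
          Ty.tsubst_eq_sub (liftSubstTVar τ) T]
    | .box T => by simp only [Shape.tsubst, Shape.sub, Ty.tsubst_eq_sub τ T]
  theorem Ty.tsubst_eq_sub (τ : ℕ → Shape) : (T : Ty) → T.tsubst τ = T.sub id τ
    | .capt C S => by
        simp only [Ty.tsubst, Ty.sub, Shape.tsubst_eq_sub τ S, CaptureSet.rename_id]
end

theorem Term.tsubst_eq_sub (t : Term) : ∀ τ : ℕ → Shape, t.tsubst τ = t.sub id τ := by
  induction t <;> intro τ <;>
    simp_all [Term.tsubst, Term.sub, lift_id, Ty.tsubst_eq_sub, Shape.tsubst_eq_sub,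
      CaptureSet.rename_id]

mutual
  theorem Shape.sub_tvar : (S : Shape) → S.sub id .tvar = S
    | .tvar X => by simp only [Shape.sub]
    | .top => by simp only [Shape.sub]
    | .all U T => by
        have h := liftSubstVar_tvar id
        simp only [id] at h
        simp only [Shape.sub, lift_id, h, Ty.sub_tvar U, Ty.sub_tvar T]
    | .tall S T => by
        have h := liftSubstTVar_tvar id
        simp only [id, lift_id] at h
        simp only [Shape.sub, h, Shape.sub_tvar S, Ty.sub_tvar T]
    | .box T => by simp only [Shape.sub, Ty.sub_tvar T]
  theorem Ty.sub_tvar : (T : Ty) → T.sub id .tvar = T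
    | .capt C S => by simp only [Ty.sub, Shape.sub_tvar S, CaptureSet.rename_id]
end

theorem liftSubstTVar_comp_lift (g : ℕ → ℕ) (τ : ℕ → Shape) :
    (fun X => liftSubstTVar τ (lift g X)) = liftSubstTVar (fun X => τ (g X)) := by
  funext X
  cases X <;> rfl

mutual
  theorem Shape.rename_sub (f g f' : ℕ → ℕ) (τ : ℕ → Shape) :
      (S : Shape) → (S.rename f g).sub f' τ = S.sub (f' ∘ f) (fun X => τ (g X))
    | .tvar X => by simp only [Shape.rename, Shape.sub]
    | .top => by simp only [Shape.rename, Shape.sub]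
    | .all U T => by
        simp only [Shape.rename, Shape.sub, Ty.rename_sub f g f' τ U,
          Ty.rename_sub (lift f) g (lift f') (liftSubstVar τ) T, lift_comp]
        rfl
    | .tall S T => by
        simp only [Shape.rename, Shape.sub, Shape.rename_sub f g f' τ S,
          Ty.rename_sub f (lift g) f' (liftSubstTVar τ) T, liftSubstTVar_comp_lift]
    | .box T => by simp only [Shape.rename, Shape.sub, Ty.rename_sub f g f' τ T]
  theorem Ty.rename_sub (f g f' : ℕ → ℕ) (τ : ℕ → Shape) :
      (T : Ty) → (T.rename f g).sub f' τ = T.sub (f' ∘ f) (fun X => τ (g X))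
    | .capt C S => by
        simp only [Ty.rename, Ty.sub, Shape.rename_sub f g f' τ S, CaptureSet.rename_comp]
end

theorem Shape.rename_rename (f g f' g' : ℕ → ℕ) (S : Shape) :
    (S.rename f g).rename f' g' = S.rename (f' ∘ f) (g' ∘ g) := by
  rw [Shape.rename_eq_sub f', Shape.rename_sub, Shape.rename_eq_sub]
  rfl

theorem Ty.rename_rename (f g f' g' : ℕ → ℕ) (T : Ty) :
    (T.rename f g).rename f' g' = T.rename (f' ∘ f) (g' ∘ g) := by
  rw [Ty.rename_eq_sub f', Ty.rename_sub, Ty.rename_eq_sub]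
  rfl

theorem liftSubstVar_rename (τ : ℕ → Shape) (f g : ℕ → ℕ) :
    (fun X => (liftSubstVar τ X).rename (lift f) g) =
      liftSubstVar (fun X => (τ X).rename f g) := by
  funext X
  simp only [liftSubstVar, Shape.rename_rename]
  rfl

theorem liftSubstTVar_rename (τ : ℕ → Shape) (f g : ℕ → ℕ) :
    (fun X => (liftSubstTVar τ X).rename f (lift g)) =
      liftSubstTVar (fun X => (τ X).rename f g) := by
  funext X
  cases X
  · simp only [liftSubstTVar, Shape.rename, lift]
  · simp only [liftSubstTVar, Shape.rename_rename]
    rfl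

mutual
  theorem Shape.sub_rename (f f' g' : ℕ → ℕ) (τ : ℕ → Shape) :
      (S : Shape) → (S.sub f τ).rename f' g' = S.sub (f' ∘ f) (fun X => (τ X).rename f' g')
    | .tvar X => by simp only [Shape.sub]
    | .top => by simp only [Shape.rename, Shape.sub]
    | .all U T => by
        simp only [Shape.rename, Shape.sub, Ty.sub_rename f f' g' τ U,
          Ty.sub_rename (lift f) (lift f') g' (liftSubstVar τ) T, lift_comp, liftSubstVar_rename]
    | .tall S T => by
        simp only [Shape.rename, Shape.sub, Shape.sub_rename f f' g' τ S,
          Ty.sub_rename f f' (lift g') (liftSubstTVar τ) T, liftSubstTVar_rename]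
    | .box T => by simp only [Shape.rename, Shape.sub, Ty.sub_rename f f' g' τ T]
  theorem Ty.sub_rename (f f' g' : ℕ → ℕ) (τ : ℕ → Shape) :
      (T : Ty) → (T.sub f τ).rename f' g' = T.sub (f' ∘ f) (fun X => (τ X).rename f' g')
    | .capt C S => by
        simp only [Ty.rename, Ty.sub, Shape.sub_rename f f' g' τ S, CaptureSet.rename_comp]
end

theorem Shape.sub_shiftVar (f : ℕ → ℕ) (τ : ℕ → Shape) (S : Shape) :
    S.shiftVar.sub (lift f) (liftSubstVar τ) = (S.sub f τ).shiftVar := by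
  rw [Shape.shiftVar, Shape.rename_sub, Shape.shiftVar, Shape.sub_rename]
  rfl

theorem Shape.sub_shiftTVar (f : ℕ → ℕ) (τ : ℕ → Shape) (S : Shape) :
    S.shiftTVar.sub f (liftSubstTVar τ) = (S.sub f τ).shiftTVar := by
  rw [Shape.shiftTVar, Shape.rename_sub, Shape.shiftTVar, Shape.sub_rename]
  rfl

theorem Ty.sub_shiftVar (f : ℕ → ℕ) (τ : ℕ → Shape) (T : Ty) :
    T.shiftVar.sub (lift f) (liftSubstVar τ) = (T.sub f τ).shiftVar := by
  rw [Ty.shiftVar, Ty.rename_sub, Ty.shiftVar, Ty.sub_rename]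
  rfl

theorem liftSubstVar_sub (τ τ' : ℕ → Shape) (f : ℕ → ℕ) :
    (fun X => (liftSubstVar τ X).sub (lift f) (liftSubstVar τ')) =
      liftSubstVar (fun X => (τ X).sub f τ') :=
  funext fun X => Shape.sub_shiftVar f τ' (τ X)

theorem liftSubstTVar_sub (τ τ' : ℕ → Shape) (f : ℕ → ℕ) :
    (fun X => (liftSubstTVar τ X).sub f (liftSubstTVar τ')) =
      liftSubstTVar (fun X => (τ X).sub f τ') := by
  funext X
  cases X with
  | zero => simp only [liftSubstTVar, Shape.sub]
  | succ X => exact Shape.sub_shiftTVar f τ' (τ X)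

mutual
  theorem Shape.sub_sub (f f' : ℕ → ℕ) (τ τ' : ℕ → Shape) :
      (S : Shape) → (S.sub f τ).sub f' τ' = S.sub (f' ∘ f) (fun X => (τ X).sub f' τ')
    | .tvar X => by simp only [Shape.sub]
    | .top => by simp only [Shape.sub]
    | .all U T => by
        simp only [Shape.sub, Ty.sub_sub f f' τ τ' U,
          Ty.sub_sub (lift f) (lift f') (liftSubstVar τ) (liftSubstVar τ') T, lift_comp,
          liftSubstVar_sub]
    | .tall S T => by
        simp only [Shape.sub, Shape.sub_sub f f' τ τ' S,
          Ty.sub_sub f f' (liftSubstTVar τ) (liftSubstTVar τ') T, liftSubstTVar_sub]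
    | .box T => by simp only [Shape.sub, Ty.sub_sub f f' τ τ' T]
  theorem Ty.sub_sub (f f' : ℕ → ℕ) (τ τ' : ℕ → Shape) :
      (T : Ty) → (T.sub f τ).sub f' τ' = T.sub (f' ∘ f) (fun X => (τ X).sub f' τ')
    | .capt C S => by
        simp only [Ty.sub, Shape.sub_sub f f' τ τ' S, CaptureSet.rename_comp]
end

theorem Ty.inst_eq_sub (T : Ty) (y : ℕ) : T.inst y = T.sub (instVar y) .tvar :=
  Ty.rename_eq_sub _ _ T

theorem Ty.tinst_eq_sub (T : Ty) (S : Shape) : T.tinst S = T.sub id (instTVar S) :=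
  Ty.tsubst_eq_sub _ T

theorem Term.inst_eq_sub (t : Term) (y : ℕ) : t.inst y = t.sub (instVar y) .tvar :=
  Term.rename_eq_sub t _ _

theorem Term.tinst_eq_sub (t : Term) (S : Shape) : t.tinst S = t.sub id (instTVar S) :=
  Term.tsubst_eq_sub t _

theorem Ty.shiftVar_inst (T : Ty) (y : ℕ) : T.shiftVar.inst y = T := by
  rw [Ty.inst_eq_sub, Ty.shiftVar, Ty.rename_sub]
  exact Ty.sub_tvar T

theorem Shape.shiftVar_sub_instVar (S : Shape) (y : ℕ) :
    S.shiftVar.sub (instVar y) .tvar = S := by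
  rw [Shape.shiftVar, Shape.rename_sub]
  exact Shape.sub_tvar S

theorem Ty.shiftVar_sub_instVar (T : Ty) (y : ℕ) : T.shiftVar.sub (instVar y) .tvar = T := by
  rw [Ty.shiftVar, Ty.rename_sub]
  exact Ty.sub_tvar T

theorem Shape.shiftTVar_sub_instTVar (S R : Shape) : S.shiftTVar.sub id (instTVar R) = S := by
  rw [Shape.shiftTVar, Shape.rename_sub]
  exact Shape.sub_tvar S

theorem Ty.shiftTVar_sub_instTVar (T : Ty) (R : Shape) :
    T.shiftTVar.sub id (instTVar R) = T := by
  rw [Ty.shiftTVar, Ty.rename_sub]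
  exact Ty.sub_tvar T

theorem Ty.inst_sub (T : Ty) (y : ℕ) (f : ℕ → ℕ) (τ : ℕ → Shape) :
    (T.inst y).sub f τ = (T.sub (lift f) (liftSubstVar τ)).inst (f y) := by
  rw [Ty.inst_eq_sub, Ty.inst_eq_sub, Ty.sub_sub, Ty.sub_sub]
  congr 1
  · funext i
    cases i <;> rfl
  · funext X
    simp only [Shape.sub]
    exact (Shape.shiftVar_sub_instVar (τ X) (f y)).symm

theorem Ty.tinst_sub (T : Ty) (S : Shape) (f : ℕ → ℕ) (τ : ℕ → Shape) :
    (T.tinst S).sub f τ = (T.sub f (liftSubstTVar τ)).tinst (S.sub f τ) := by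
  rw [Ty.tinst_eq_sub, Ty.tinst_eq_sub, Ty.sub_sub, Ty.sub_sub]
  congr 1
  funext X
  cases X with
  | zero => simp only [instTVar, liftSubstTVar, Shape.sub]
  | succ X =>
    simp only [instTVar, Shape.sub]
    exact (Shape.shiftTVar_sub_instTVar (τ X) _).symm

theorem Term.isValue_sub (f : ℕ → ℕ) (τ : ℕ → Shape) (t : Term) :
    (t.sub f τ).isValue = t.isValue := by
  cases t <;> rfl

theorem Term.cv_sub (t : Term) : ∀ (f : ℕ → ℕ) (τ : ℕ → Shape),
    (t.sub f τ).cv = CaptureSet.rename f t.cv := by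
  induction t with
  | var x => intro f τ; simp [Term.sub, Term.cv, CaptureSet.rename_singleton, Cap.rename]
  | abs U t ih => intro f τ; simp only [Term.sub, Term.cv, ih, CaptureSet.unbind_rename_lift]
  | tabs S t ih => intro f τ; simp only [Term.sub, Term.cv, ih]
  | box x => intro f τ; simp [Term.sub, Term.cv, CaptureSet.rename]
  | app x y => intro f τ; simp [Term.sub, Term.cv, CaptureSet.rename, Cap.rename]
  | tapp x S => intro f τ; simp [Term.sub, Term.cv, CaptureSet.rename_singleton, Cap.rename]
  | letIn s t ihs iht =>
    intro f τ
    simp only [Term.sub, Term.cv, ihs, iht, Term.isValue_sub, CaptureSet.zero_mem_rename_lift,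
      CaptureSet.unbind_rename_lift]
    split_ifs
    · rfl
    · rw [CaptureSet.rename_union]
  | unbox C x =>
    intro f τ
    simp only [Term.sub, Term.cv, CaptureSet.rename_union, CaptureSet.rename_singleton, Cap.rename]


/-! ## Lookup in environments -/

theorem Ctx.HasVar.unique {Γ : Ctx} {x : ℕ} {T U : Ty} (h : Γ.HasVar x T) (h' : Γ.HasVar x U) :
    T = U := by
  induction h generalizing U with
  | here => cases h'; rfl
  | var _ ih => cases h' with | var h' => rw [ih h']
  | tvar _ ih => cases h' with | tvar h' => rw [ih h']

theorem Ctx.var_mem_dom {Γ : Ctx} {x : ℕ} : Cap.var x ∈ Γ.dom ↔ ∃ T, Γ.HasVar x T := by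
  constructor
  · rintro ⟨y, T, e, h⟩
    cases e
    exact ⟨T, h⟩
  · rintro ⟨T, h⟩
    exact ⟨x, T, rfl, h⟩

theorem Ctx.star_notMem_dom {Γ : Ctx} : Cap.star ∉ Γ.dom := by
  rintro ⟨y, T, e, h⟩
  cases e

theorem Ctx.zero_mem_dom_var {Γ : Ctx} {T : Ty} : Cap.var 0 ∈ (Γ.var T).dom :=
  Ctx.var_mem_dom.2 ⟨_, .here⟩

theorem Ctx.succ_mem_dom_var {Γ : Ctx} {T : Ty} {x : ℕ} :
    Cap.var (x + 1) ∈ (Γ.var T).dom ↔ Cap.var x ∈ Γ.dom := by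
  rw [Ctx.var_mem_dom, Ctx.var_mem_dom]
  constructor
  · rintro ⟨_, h⟩
    cases h with | var h => exact ⟨_, h⟩
  · rintro ⟨_, h⟩
    exact ⟨_, .var h⟩

theorem Ctx.dom_tvar {Γ : Ctx} {S : Shape} : (Γ.tvar S).dom = Γ.dom := by
  ext (_ | x)
  · simp only [Ctx.star_notMem_dom]
  · rw [Ctx.var_mem_dom, Ctx.var_mem_dom]
    constructor
    · rintro ⟨_, h⟩
      cases h with | tvar h => exact ⟨_, h⟩
    · rintro ⟨_, h⟩
      exact ⟨_, .tvar h⟩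

/-- The type variables bound in `Γ`. -/
def Ctx.tdom (Γ : Ctx) : Set ℕ := {X | ∃ S, Γ.HasTVar X S}

theorem Ctx.tdom_var {Γ : Ctx} {T : Ty} : (Γ.var T).tdom = Γ.tdom := by
  ext X
  constructor
  · rintro ⟨_, h⟩
    cases h with | var h => exact ⟨_, h⟩
  · rintro ⟨_, h⟩
    exact ⟨_, .var h⟩

theorem Ctx.zero_mem_tdom_tvar {Γ : Ctx} {S : Shape} : 0 ∈ (Γ.tvar S).tdom := ⟨_, .here⟩

theorem Ctx.succ_mem_tdom_tvar {Γ : Ctx} {S : Shape} {X : ℕ} :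
    X + 1 ∈ (Γ.tvar S).tdom ↔ X ∈ Γ.tdom := by
  constructor
  · rintro ⟨_, h⟩
    cases h with | tvar h => exact ⟨_, h⟩
  · rintro ⟨_, h⟩
    exact ⟨_, .tvar h⟩

/-! ## Well-formedness under substitution -/

/-- `f` maps the term variables of `Γ` to term variables of `Γ'`. -/
def MapsDom (f : ℕ → ℕ) (Γ Γ' : Ctx) : Prop :=
  ∀ x, Cap.var x ∈ Γ.dom → Cap.var (f x) ∈ Γ'.dom

theorem MapsDom.lift {f : ℕ → ℕ} {Γ Γ' : Ctx} (h : MapsDom f Γ Γ') (T U : Ty) :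
    MapsDom (lift f) (Γ.var T) (Γ'.var U)
  | 0, _ => Ctx.zero_mem_dom_var
  | x + 1, hx => Ctx.succ_mem_dom_var.2 (h x (Ctx.succ_mem_dom_var.1 hx))

theorem MapsDom.tvar {f : ℕ → ℕ} {Γ Γ' : Ctx} (h : MapsDom f Γ Γ') (S R : Shape) :
    MapsDom f (Γ.tvar S) (Γ'.tvar R) := fun x hx => by
  rw [Ctx.dom_tvar] at hx ⊢
  exact h x hx

theorem MapsDom.rename_subset {f : ℕ → ℕ} {Γ Γ' : Ctx} (h : MapsDom f Γ Γ') {C : CaptureSet}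
    (hC : (C : Set Cap) ⊆ Γ.dom) : (CaptureSet.rename f C : Set Cap) ⊆ Γ'.dom := by
  intro c hc
  obtain ⟨(_ | x), hd, rfl⟩ := CaptureSet.mem_rename.1 (Finset.mem_coe.1 hc)
  · exact absurd (hC (Finset.mem_coe.2 hd)) Ctx.star_notMem_dom
  · exact h x (hC (Finset.mem_coe.2 hd))

theorem MapsDom.rename_subset_star {f : ℕ → ℕ} {Γ Γ' : Ctx} (h : MapsDom f Γ Γ')
    {C : CaptureSet} (hC : (C : Set Cap) ⊆ Γ.dom ∪ {Cap.star}) :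
    (CaptureSet.rename f C : Set Cap) ⊆ Γ'.dom ∪ {Cap.star} := by
  intro c hc
  obtain ⟨(_ | x), hd, rfl⟩ := CaptureSet.mem_rename.1 (Finset.mem_coe.1 hc)
  · exact Or.inr rfl
  · rcases hC (Finset.mem_coe.2 hd) with hx | hx
    · exact Or.inl (h x hx)
    · cases hx

theorem mapsTo_lift_tdom {g : ℕ → ℕ} {Γ Γ' : Ctx} (h : Set.MapsTo g Γ.tdom Γ'.tdom)
    (S R : Shape) : Set.MapsTo (lift g) (Γ.tvar S).tdom (Γ'.tvar R).tdom
  | 0, _ => Ctx.zero_mem_tdom_tvar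
  | _ + 1, hX => Ctx.succ_mem_tdom_tvar.2 (h (Ctx.succ_mem_tdom_tvar.1 hX))

mutual
  theorem Shape.WF.rename : (S : Shape) → ∀ {f g : ℕ → ℕ} {Γ Γ' : Ctx}, MapsDom f Γ Γ' →
      Set.MapsTo g Γ.tdom Γ'.tdom → Shape.WF Γ S → Shape.WF Γ' (S.rename f g)
    | .tvar X, f, g, Γ, Γ', _, ht, h => by
        cases h with
        | tvar h =>
          obtain ⟨R, hR⟩ := ht ⟨_, h⟩
          simp only [Shape.rename]
          exact .tvar hR
    | .top, f, g, Γ, Γ', _, _, _ => by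
        simp only [Shape.rename]
        exact .top
    | .all U T, f, g, Γ, Γ', hv, ht, h => by
        cases h with
        | all hU hT =>
          simp only [Shape.rename]
          exact .all (Ty.WF.rename U hv ht hU)
            (Ty.WF.rename T (hv.lift _ _) (by rwa [Ctx.tdom_var, Ctx.tdom_var]) hT)
    | .tall S T, f, g, Γ, Γ', hv, ht, h => by
        cases h with
        | tall hS hT =>
          simp only [Shape.rename]
          exact .tall (Shape.WF.rename S hv ht hS)
            (Ty.WF.rename T (hv.tvar _ _) (mapsTo_lift_tdom ht _ _) hT)
    | .box T, f, g, Γ, Γ', hv, ht, h => by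
        cases h with
        | box hT =>
          simp only [Shape.rename]
          exact .box (Ty.WF.rename T hv ht hT)
  theorem Ty.WF.rename : (T : Ty) → ∀ {f g : ℕ → ℕ} {Γ Γ' : Ctx}, MapsDom f Γ Γ' →
      Set.MapsTo g Γ.tdom Γ'.tdom → Ty.WF Γ T → Ty.WF Γ' (T.rename f g)
    | .capt C S, f, g, Γ, Γ', hv, ht, h => by
        cases h with
        | capt hS hC =>
          simp only [Ty.rename]
          exact .capt (Shape.WF.rename S hv ht hS) (hv.rename_subset_star hC)
end

theorem mapsDom_succ (Γ : Ctx) (T : Ty) : MapsDom Nat.succ Γ (Γ.var T) :=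
  fun _ hx => Ctx.succ_mem_dom_var.2 hx

theorem mapsDom_id_tvar (Γ : Ctx) (S : Shape) : MapsDom id Γ (Γ.tvar S) :=
  fun _ hx => by rwa [Ctx.dom_tvar]

theorem Shape.WF.shiftVar {Γ : Ctx} {S : Shape} (h : Shape.WF Γ S) (U : Ty) :
    Shape.WF (Γ.var U) S.shiftVar :=
  h.rename S (mapsDom_succ Γ U) (by rw [Ctx.tdom_var]; exact Set.mapsTo_id _)

theorem Shape.WF.shiftTVar {Γ : Ctx} {S : Shape} (h : Shape.WF Γ S) (R : Shape) :
    Shape.WF (Γ.tvar R) S.shiftTVar :=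
  h.rename S (mapsDom_id_tvar Γ R) (fun _ hX => Ctx.succ_mem_tdom_tvar.2 hX)

theorem Ty.WF.shiftVar {Γ : Ctx} {T : Ty} (h : Ty.WF Γ T) (U : Ty) :
    Ty.WF (Γ.var U) T.shiftVar :=
  h.rename T (mapsDom_succ Γ U) (by rw [Ctx.tdom_var]; exact Set.mapsTo_id _)

theorem Ty.WF.shiftTVar {Γ : Ctx} {T : Ty} (h : Ty.WF Γ T) (R : Shape) :
    Ty.WF (Γ.tvar R) T.shiftTVar :=
  h.rename T (mapsDom_id_tvar Γ R) (fun _ hX => Ctx.succ_mem_tdom_tvar.2 hX)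

/-- `τ` maps the type variables of `Γ` to well-formed shape types over `Γ'`. -/
def MapsTDom (τ : ℕ → Shape) (Γ Γ' : Ctx) : Prop :=
  ∀ X ∈ Γ.tdom, Shape.WF Γ' (τ X)

theorem MapsTDom.liftVar {τ : ℕ → Shape} {Γ Γ' : Ctx} (h : MapsTDom τ Γ Γ') (T U : Ty) :
    MapsTDom (liftSubstVar τ) (Γ.var T) (Γ'.var U) := fun X hX => by
  rw [Ctx.tdom_var] at hX
  exact (h X hX).shiftVar U

theorem MapsTDom.liftTVar {τ : ℕ → Shape} {Γ Γ' : Ctx} (h : MapsTDom τ Γ Γ') (S R : Shape) :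
    MapsTDom (liftSubstTVar τ) (Γ.tvar S) (Γ'.tvar R)
  | 0, _ => .tvar .here
  | X + 1, hX => (h X (Ctx.succ_mem_tdom_tvar.1 hX)).shiftTVar R

mutual
  theorem Shape.WF.sub : (S : Shape) → ∀ {f : ℕ → ℕ} {τ : ℕ → Shape} {Γ Γ' : Ctx},
      MapsDom f Γ Γ' → MapsTDom τ Γ Γ' → Shape.WF Γ S → Shape.WF Γ' (S.sub f τ)
    | .tvar X, f, τ, Γ, Γ', _, ht, h => by
        cases h with
        | tvar h =>
          simp only [Shape.sub]
          exact ht X ⟨_, h⟩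
    | .top, f, τ, Γ, Γ', _, _, _ => by
        simp only [Shape.sub]
        exact .top
    | .all U T, f, τ, Γ, Γ', hv, ht, h => by
        cases h with
        | all hU hT =>
          simp only [Shape.sub]
          exact .all (Ty.WF.sub U hv ht hU) (Ty.WF.sub T (hv.lift _ _) (ht.liftVar _ _) hT)
    | .tall S T, f, τ, Γ, Γ', hv, ht, h => by
        cases h with
        | tall hS hT =>
          simp only [Shape.sub]
          exact .tall (Shape.WF.sub S hv ht hS) (Ty.WF.sub T (hv.tvar _ _) (ht.liftTVar _ _) hT)
    | .box T, f, τ, Γ, Γ', hv, ht, h => by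
        cases h with
        | box hT =>
          simp only [Shape.sub]
          exact .box (Ty.WF.sub T hv ht hT)
  theorem Ty.WF.sub : (T : Ty) → ∀ {f : ℕ → ℕ} {τ : ℕ → Shape} {Γ Γ' : Ctx},
      MapsDom f Γ Γ' → MapsTDom τ Γ Γ' → Ty.WF Γ T → Ty.WF Γ' (T.sub f τ)
    | .capt C S, f, τ, Γ, Γ', hv, ht, h => by
        cases h with
        | capt hS hC =>
          simp only [Ty.sub]
          exact .capt (Shape.WF.sub S hv ht hS) (hv.rename_subset_star hC)
end

/-- `f` reflects membership of term variables in the domain. -/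
def ReflectsDom (f : ℕ → ℕ) (Γ Γ' : Ctx) : Prop :=
  ∀ x, Cap.var (f x) ∈ Γ'.dom → Cap.var x ∈ Γ.dom

theorem ReflectsDom.lift {f : ℕ → ℕ} {Γ Γ' : Ctx} (h : ReflectsDom f Γ Γ') (T U : Ty) :
    ReflectsDom (lift f) (Γ.var T) (Γ'.var U)
  | 0, _ => Ctx.zero_mem_dom_var
  | x + 1, hx => Ctx.succ_mem_dom_var.2 (h x (Ctx.succ_mem_dom_var.1 hx))

mutual
  theorem Shape.WF.of_rename : (S : Shape) → ∀ {f g : ℕ → ℕ} {Γ Γ' : Ctx}, ReflectsDom f Γ Γ' →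
      (∀ X, g X ∈ Γ'.tdom → X ∈ Γ.tdom) → Shape.WF Γ' (S.rename f g) → Shape.WF Γ S
    | .tvar X, f, g, Γ, Γ', _, ht, h => by
        simp only [Shape.rename] at h
        cases h with
        | tvar h =>
          obtain ⟨R, hR⟩ := ht X ⟨_, h⟩
          exact .tvar hR
    | .top, f, g, Γ, Γ', _, _, _ => .top
    | .all U T, f, g, Γ, Γ', hv, ht, h => by
        simp only [Shape.rename] at h
        cases h with
        | all hU hT =>
          exact .all (Ty.WF.of_rename U hv ht hU)
            (Ty.WF.of_rename T (hv.lift _ _) (by rwa [Ctx.tdom_var, Ctx.tdom_var]) hT)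
    | .tall S T, f, g, Γ, Γ', hv, ht, h => by
        simp only [Shape.rename] at h
        cases h with
        | tall hS hT =>
          refine .tall (Shape.WF.of_rename S hv ht hS) (Ty.WF.of_rename T (fun x hx => ?_) ?_ hT)
          · rw [Ctx.dom_tvar] at hx ⊢
            exact hv x hx
          · rintro (_ | X) hX
            · exact Ctx.zero_mem_tdom_tvar
            · exact Ctx.succ_mem_tdom_tvar.2 (ht X (Ctx.succ_mem_tdom_tvar.1 hX))
    | .box T, f, g, Γ, Γ', hv, ht, h => by
        simp only [Shape.rename] at h
        cases h with
        | box hT => exact .box (Ty.WF.of_rename T hv ht hT)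
  theorem Ty.WF.of_rename : (T : Ty) → ∀ {f g : ℕ → ℕ} {Γ Γ' : Ctx}, ReflectsDom f Γ Γ' →
      (∀ X, g X ∈ Γ'.tdom → X ∈ Γ.tdom) → Ty.WF Γ' (T.rename f g) → Ty.WF Γ T
    | .capt C S, f, g, Γ, Γ', hv, ht, h => by
        simp only [Ty.rename] at h
        cases h with
        | capt hS hC =>
          refine .capt (Shape.WF.of_rename S hv ht hS) ?_
          rintro (_ | x) hx
          · exact Or.inr rfl
          · have hm : Cap.var (f x) ∈ CaptureSet.rename f C :=
              CaptureSet.mem_rename.2 ⟨_, Finset.mem_coe.1 hx, rfl⟩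
            rcases hC (Finset.mem_coe.2 hm) with h' | h'
            · exact Or.inl (hv x h')
            · cases h'
end

theorem Ty.WF.of_shiftVar {Γ : Ctx} {T U : Ty} (h : Ty.WF (Γ.var U) T.shiftVar) : Ty.WF Γ T :=
  Ty.WF.of_rename T (fun _ hx => Ctx.succ_mem_dom_var.1 hx)
    (fun _ hX => by rwa [Ctx.tdom_var] at hX) h

theorem Ty.WF.inst {Γ : Ctx} {T U : Ty} {y : ℕ} (h : Ty.WF (Γ.var U) T)
    (hy : Cap.var y ∈ Γ.dom) : Ty.WF Γ (T.inst y) := by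
  rw [Ty.inst_eq_sub]
  refine Ty.WF.sub T ?_ ?_ h
  · rintro (_ | x) hx
    · exact hy
    · exact Ctx.succ_mem_dom_var.1 hx
  · rintro X hX
    rw [Ctx.tdom_var] at hX
    obtain ⟨S, hS⟩ := hX
    exact .tvar hS

theorem Ty.WF.tinst {Γ : Ctx} {T : Ty} {R S : Shape} (h : Ty.WF (Γ.tvar R) T)
    (hS : Shape.WF Γ S) : Ty.WF Γ (T.tinst S) := by
  rw [Ty.tinst_eq_sub]
  refine Ty.WF.sub T ?_ ?_ h
  · intro x hx
    rwa [Ctx.dom_tvar] at hx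
  · rintro (_ | X) hX
    · exact hS
    · obtain ⟨S, hS⟩ := Ctx.succ_mem_tdom_tvar.1 hX
      exact .tvar hS

theorem Ctx.WF.hasVar {Γ : Ctx} {x : ℕ} {T : Ty} (hΓ : Γ.WF) (h : Γ.HasVar x T) :
    Ty.WF Γ T := by
  induction h with
  | here => cases hΓ with | var _ hT => exact hT.shiftVar _
  | var _ ih => cases hΓ with | var hΓ _ => exact (ih hΓ).shiftVar _
  | tvar _ ih => cases hΓ with | tvar hΓ _ => exact (ih hΓ).shiftTVar _

/-! ## Subcapturing and subtyping under renaming -/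

theorem Subcapt.of_subset {Γ : Ctx} {C D : CaptureSet} (h : C ⊆ D) : Subcapt Γ C D :=
  .sc_set fun _ hc => .sc_elem (h hc)

theorem Subcapt.refl (Γ : Ctx) (C : CaptureSet) : Subcapt Γ C C := .of_subset subset_rfl

theorem Subcapt.elem {Γ : Ctx} {C D : CaptureSet} (h : Subcapt Γ C D) :
    ∀ c ∈ C, Subcapt Γ {c} D := by
  intro c hc
  cases h with
  | sc_elem h => rw [Finset.mem_singleton.1 hc]; exact .sc_elem h
  | sc_set h => exact h c hc
  | sc_var hx h => rw [Finset.mem_singleton.1 hc]; exact .sc_var hx h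

theorem Subcapt.trans {Γ : Ctx} {C D E : CaptureSet} (h : Subcapt Γ C D) (h' : Subcapt Γ D E) :
    Subcapt Γ C E := by
  induction h with
  | sc_elem hc => exact h'.elem _ hc
  | sc_set _ ih => exact .sc_set fun c hc => ih c hc h'
  | sc_var hx _ ih => exact .sc_var hx (ih h')

/-- Renaming `Γ` by `f` and `g` yields bindings of `Γ'`. -/
structure Ren (f g : ℕ → ℕ) (Γ Γ' : Ctx) : Prop where
  var : ∀ {x T}, Γ.HasVar x T → Γ'.HasVar (f x) (T.rename f g)
  tvar : ∀ {X S}, Γ.HasTVar X S → Γ'.HasTVar (g X) (S.rename f g)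

theorem Ty.shiftVar_rename (f g : ℕ → ℕ) (T : Ty) :
    T.shiftVar.rename (lift f) g = (T.rename f g).shiftVar := by
  rw [Ty.shiftVar, Ty.shiftVar, Ty.rename_rename, Ty.rename_rename]
  rfl

theorem Ty.shiftTVar_rename (f g : ℕ → ℕ) (T : Ty) :
    T.shiftTVar.rename f (lift g) = (T.rename f g).shiftTVar := by
  rw [Ty.shiftTVar, Ty.shiftTVar, Ty.rename_rename, Ty.rename_rename]
  rfl

theorem Shape.shiftVar_rename (f g : ℕ → ℕ) (S : Shape) :
    S.shiftVar.rename (lift f) g = (S.rename f g).shiftVar := by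
  rw [Shape.shiftVar, Shape.shiftVar, Shape.rename_rename, Shape.rename_rename]
  rfl

theorem Shape.shiftTVar_rename (f g : ℕ → ℕ) (S : Shape) :
    S.shiftTVar.rename f (lift g) = (S.rename f g).shiftTVar := by
  rw [Shape.shiftTVar, Shape.shiftTVar, Shape.rename_rename, Shape.rename_rename]
  rfl

theorem Ren.liftVar {f g : ℕ → ℕ} {Γ Γ' : Ctx} (h : Ren f g Γ Γ') (U : Ty) :
    Ren (lift f) g (Γ.var U) (Γ'.var (U.rename f g)) where
  var hx := by
    cases hx with
    | here => rw [Ty.shiftVar_rename]; exact .here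
    | var hx => rw [Ty.shiftVar_rename]; exact .var (h.var hx)
  tvar hX := by
    cases hX with
    | var hX => rw [Shape.shiftVar_rename]; exact .var (h.tvar hX)

theorem Ren.liftTVar {f g : ℕ → ℕ} {Γ Γ' : Ctx} (h : Ren f g Γ Γ') (R : Shape) :
    Ren f (lift g) (Γ.tvar R) (Γ'.tvar (R.rename f g)) where
  var hx := by
    cases hx with
    | tvar hx => rw [Ty.shiftTVar_rename]; exact .tvar (h.var hx)
  tvar hX := by
    cases hX with
    | here => rw [Shape.shiftTVar_rename]; exact .here
    | tvar hX => rw [Shape.shiftTVar_rename]; exact .tvar (h.tvar hX)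

theorem Subcapt.rename_of {f : ℕ → ℕ} {Γ Γ' : Ctx} {C D : CaptureSet}
    (hv : ∀ {x C S}, Γ.HasVar x (.capt C S) → Subcapt Γ' {.var (f x)} (CaptureSet.rename f C))
    (h : Subcapt Γ C D) : Subcapt Γ' (CaptureSet.rename f C) (CaptureSet.rename f D) := by
  induction h with
  | sc_elem hc =>
    rw [CaptureSet.rename_singleton]
    exact .sc_elem (CaptureSet.mem_rename.2 ⟨_, hc, rfl⟩)
  | sc_set _ ih =>
    refine .sc_set fun c hc => ?_
    obtain ⟨d, hd, rfl⟩ := CaptureSet.mem_rename.1 hc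
    rw [← CaptureSet.rename_singleton]
    exact ih d hd
  | sc_var hx _ ih =>
    rw [CaptureSet.rename_singleton]
    exact (hv hx).trans ih

theorem Subcapt.rename {f g : ℕ → ℕ} {Γ Γ' : Ctx} {C D : CaptureSet} (hr : Ren f g Γ Γ')
    (h : Subcapt Γ C D) : Subcapt Γ' (CaptureSet.rename f C) (CaptureSet.rename f D) :=
  h.rename_of fun hx => .sc_var (by simpa only [Ty.rename] using hr.var hx) (.refl _ _)

theorem CaptureSet.rename_empty (f : ℕ → ℕ) : CaptureSet.rename f ∅ = ∅ := Finset.image_empty _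

theorem Subtyp.rename {f g : ℕ → ℕ} {Γ Γ' : Ctx} {T U : Ty} (hr : Ren f g Γ Γ')
    (h : Subtyp Γ T U) : Subtyp Γ' (T.rename f g) (U.rename f g) := by
  induction h generalizing f g Γ' with
  | refl => exact .refl
  | trans _ _ ih₁ ih₂ => exact .trans (ih₁ hr) (ih₂ hr)
  | tvar h =>
    simp only [Ty.rename, Shape.rename, CaptureSet.rename_empty]
    exact .tvar (hr.tvar h)
  | top =>
    simp only [Ty.rename, Shape.rename, CaptureSet.rename_empty]
    exact .top
  | fn _ _ ih₁ ih₂ =>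
    simp only [Ty.rename, Shape.rename, CaptureSet.rename_empty]
    exact .fn (ih₁ hr) (ih₂ (hr.liftVar _))
  | tfn _ _ ih₁ ih₂ =>
    simp only [Ty.rename, Shape.rename, CaptureSet.rename_empty] at ih₁ ⊢
    exact .tfn (ih₁ hr) (ih₂ (hr.liftTVar _))
  | capt hC _ ih =>
    simp only [Ty.rename, CaptureSet.rename_empty] at ih ⊢
    exact .capt (hC.rename hr) (ih hr)
  | boxed _ ih =>
    simp only [Ty.rename, Shape.rename, CaptureSet.rename_empty]
    exact .boxed (ih hr)

theorem Ty.rename_id (T : Ty) : T.rename id id = T :=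
  (Ty.rename_eq_sub id id T).trans (Ty.sub_tvar T)

theorem Shape.rename_id (S : Shape) : S.rename id id = S :=
  (Shape.rename_eq_sub id id S).trans (Shape.sub_tvar S)

theorem Ren.shiftVar (Γ : Ctx) (U : Ty) : Ren Nat.succ id Γ (Γ.var U) := ⟨.var, .var⟩

theorem Ren.shiftTVar (Γ : Ctx) (R : Shape) : Ren id Nat.succ Γ (Γ.tvar R) := ⟨.tvar, .tvar⟩

theorem Subtyp.shiftVar {Γ : Ctx} {T T' : Ty} (h : Subtyp Γ T T') (U : Ty) :
    Subtyp (Γ.var U) T.shiftVar T'.shiftVar := h.rename (.shiftVar Γ U)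

theorem Subtyp.shiftTVar {Γ : Ctx} {T T' : Ty} (h : Subtyp Γ T T') (R : Shape) :
    Subtyp (Γ.tvar R) T.shiftTVar T'.shiftTVar := h.rename (.shiftTVar Γ R)

theorem Subtyp.toTy_shiftVar {Γ : Ctx} {S S' : Shape} (h : Subtyp Γ S.toTy S'.toTy) (U : Ty) :
    Subtyp (Γ.var U) S.shiftVar.toTy S'.shiftVar.toTy := by
  simpa only [Shape.toTy, Ty.shiftVar, Ty.rename, CaptureSet.rename_empty] using h.shiftVar U

theorem Subtyp.toTy_shiftTVar {Γ : Ctx} {S S' : Shape} (h : Subtyp Γ S.toTy S'.toTy)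
    (R : Shape) : Subtyp (Γ.tvar R) S.shiftTVar.toTy S'.shiftTVar.toTy := by
  simpa only [Shape.toTy, Ty.shiftTVar, Ty.rename, CaptureSet.rename_empty] using h.shiftTVar R

/-! ## Subcapturing and subtyping under substitution -/

/-- A substitution from `Γ` to `Γ'`; the bindings of `Γ` may be narrowed by the way. -/
structure Subst (f : ℕ → ℕ) (τ : ℕ → Shape) (Γ Γ' : Ctx) : Prop where
  var : ∀ {x C S}, Γ.HasVar x (.capt C S) → ∃ C' S', Γ'.HasVar (f x) (.capt C' S') ∧
    Subcapt Γ' {.var (f x)} (CaptureSet.rename f C) ∧ Subtyp Γ' S'.toTy (S.sub f τ).toTy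
  tvar : ∀ {X S}, Γ.HasTVar X S →
    Shape.WF Γ' (τ X) ∧ Subtyp Γ' (τ X).toTy (S.sub f τ).toTy

theorem Subst.mapsDom {f : ℕ → ℕ} {τ : ℕ → Shape} {Γ Γ' : Ctx} (h : Subst f τ Γ Γ') :
    MapsDom f Γ Γ' := fun x hx => by
  obtain ⟨⟨C, S⟩, hT⟩ := Ctx.var_mem_dom.1 hx
  obtain ⟨C', S', h', -⟩ := h.var hT
  exact Ctx.var_mem_dom.2 ⟨_, h'⟩

theorem Subst.mapsTDom {f : ℕ → ℕ} {τ : ℕ → Shape} {Γ Γ' : Ctx} (h : Subst f τ Γ Γ') :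
    MapsTDom τ Γ Γ' := fun _ ⟨_, hS⟩ => (h.tvar hS).1

/-- Extension of a substitution by a term binding whose type is narrowed. -/
theorem Subst.narrowVar {f : ℕ → ℕ} {τ : ℕ → Shape} {Γ Γ' : Ctx} (h : Subst f τ Γ Γ')
    {C D : CaptureSet} {S R : Shape} (hC : Subcapt Γ' D (CaptureSet.rename f C))
    (hS : Subtyp Γ' R.toTy (S.sub f τ).toTy) :
    Subst (lift f) (liftSubstVar τ) (Γ.var (.capt C S)) (Γ'.var (.capt D R)) where
  var := by
    have key : ∀ {x T}, (Γ.var (.capt C S)).HasVar x T → ∀ {C₁ S₁}, T = .capt C₁ S₁ →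
        ∃ C' S', (Γ'.var (.capt D R)).HasVar (lift f x) (.capt C' S') ∧
        Subcapt (Γ'.var (.capt D R)) {.var (lift f x)} (CaptureSet.rename (lift f) C₁) ∧
        Subtyp (Γ'.var (.capt D R)) S'.toTy (S₁.sub (lift f) (liftSubstVar τ)).toTy := by
      intro x T hx C₁ S₁ e
      cases hx with
      | here =>
        simp only [Ty.shiftVar, Ty.rename, Ty.capt.injEq] at e
        obtain ⟨rfl, rfl⟩ := e
        have h0 : (Γ'.var (.capt D R)).HasVar 0
            (.capt (CaptureSet.rename Nat.succ D) R.shiftVar) := by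
          simpa only [Ty.shiftVar, Ty.rename] using Ctx.HasVar.here (Γ := Γ') (T := .capt D R)
        refine ⟨_, _, h0, ?_, ?_⟩
        · refine .sc_var h0 ?_
          have := hC.rename (.shiftVar Γ' (.capt D R))
          rwa [CaptureSet.rename_comp, ← lift_comp_succ, ← CaptureSet.rename_comp] at this
        · have := hS.toTy_shiftVar (.capt D R)
          rwa [← Shape.sub_shiftVar] at this
      | @var _ x T _ hx =>
        obtain ⟨C₂, S₂⟩ := T
        simp only [Ty.shiftVar, Ty.rename, Ty.capt.injEq] at e
        obtain ⟨rfl, rfl⟩ := e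
        obtain ⟨C', S', h1, h2, h3⟩ := h.var hx
        have h1' := h1.var (U := .capt D R)
        rw [Ty.shiftVar, Ty.rename] at h1'
        refine ⟨_, _, h1', ?_, ?_⟩
        · have := h2.rename (.shiftVar Γ' (.capt D R))
          rwa [CaptureSet.rename_comp, ← lift_comp_succ, ← CaptureSet.rename_comp,
            CaptureSet.rename_singleton] at this
        · have := h3.toTy_shiftVar (.capt D R)
          rwa [← Shape.sub_shiftVar] at this
    exact fun {_ _ _} hx => key hx rfl
  tvar hX := by
    cases hX with
    | var hX =>
      obtain ⟨h1, h2⟩ := h.tvar hX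
      refine ⟨h1.shiftVar _, ?_⟩
      have := h2.toTy_shiftVar (.capt D R)
      rwa [← Shape.sub_shiftVar] at this

theorem Subst.liftVar {f : ℕ → ℕ} {τ : ℕ → Shape} {Γ Γ' : Ctx} (h : Subst f τ Γ Γ') (U : Ty) :
    Subst (lift f) (liftSubstVar τ) (Γ.var U) (Γ'.var (U.sub f τ)) := by
  obtain ⟨C, S⟩ := U
  exact h.narrowVar (.refl _ _) .refl

/-- Extension of a substitution by a type binding whose bound is narrowed. -/
theorem Subst.narrowTVar {f : ℕ → ℕ} {τ : ℕ → Shape} {Γ Γ' : Ctx} (h : Subst f τ Γ Γ')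
    {S R : Shape} (hS : Subtyp Γ' R.toTy (S.sub f τ).toTy) :
    Subst f (liftSubstTVar τ) (Γ.tvar S) (Γ'.tvar R) where
  var := by
    have key : ∀ {x T}, (Γ.tvar S).HasVar x T → ∀ {C₁ S₁}, T = .capt C₁ S₁ →
        ∃ C' S', (Γ'.tvar R).HasVar (f x) (.capt C' S') ∧
        Subcapt (Γ'.tvar R) {.var (f x)} (CaptureSet.rename f C₁) ∧
        Subtyp (Γ'.tvar R) S'.toTy (S₁.sub f (liftSubstTVar τ)).toTy := by
      intro x T hx C₁ S₁ e
      cases hx with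
      | @tvar _ x T _ hx =>
        obtain ⟨C₂, S₂⟩ := T
        simp only [Ty.shiftTVar, Ty.rename, Ty.capt.injEq, CaptureSet.rename_id] at e
        obtain ⟨rfl, rfl⟩ := e
        obtain ⟨C', S', h1, h2, h3⟩ := h.var hx
        refine ⟨_, _, by simpa only [Ty.shiftTVar, Ty.rename] using h1.tvar, ?_, ?_⟩
        · have := h2.rename (.shiftTVar Γ' R)
          rwa [CaptureSet.rename_id, CaptureSet.rename_id] at this
        · have := h3.toTy_shiftTVar R
          rwa [← Shape.sub_shiftTVar] at this
    exact fun {_ _ _} hx => key hx rfl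
  tvar hX := by
    cases hX with
    | here =>
      refine ⟨.tvar .here, .trans (.tvar .here) ?_⟩
      have := hS.toTy_shiftTVar R
      rwa [← Shape.sub_shiftTVar] at this
    | tvar hX =>
      obtain ⟨h1, h2⟩ := h.tvar hX
      refine ⟨h1.shiftTVar _, ?_⟩
      have := h2.toTy_shiftTVar R
      rwa [← Shape.sub_shiftTVar] at this

theorem Subst.liftTVar {f : ℕ → ℕ} {τ : ℕ → Shape} {Γ Γ' : Ctx} (h : Subst f τ Γ Γ')
    (S : Shape) : Subst f (liftSubstTVar τ) (Γ.tvar S) (Γ'.tvar (S.sub f τ)) :=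
  h.narrowTVar .refl

theorem Subcapt.sub {f : ℕ → ℕ} {τ : ℕ → Shape} {Γ Γ' : Ctx} {C D : CaptureSet}
    (hs : Subst f τ Γ Γ') (h : Subcapt Γ C D) :
    Subcapt Γ' (CaptureSet.rename f C) (CaptureSet.rename f D) :=
  h.rename_of fun hx => by
    obtain ⟨_, _, _, h', _⟩ := hs.var hx
    exact h'

theorem Subtyp.sub {f : ℕ → ℕ} {τ : ℕ → Shape} {Γ Γ' : Ctx} {T U : Ty} (hs : Subst f τ Γ Γ')
    (h : Subtyp Γ T U) : Subtyp Γ' (T.sub f τ) (U.sub f τ) := by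
  induction h generalizing f τ Γ' with
  | refl => exact .refl
  | trans _ _ ih₁ ih₂ => exact .trans (ih₁ hs) (ih₂ hs)
  | tvar h =>
    simp only [Ty.sub, Shape.sub, CaptureSet.rename_empty]
    exact (hs.tvar h).2
  | top =>
    simp only [Ty.sub, Shape.sub, CaptureSet.rename_empty]
    exact .top
  | fn _ _ ih₁ ih₂ =>
    simp only [Ty.sub, Shape.sub, CaptureSet.rename_empty]
    exact .fn (ih₁ hs) (ih₂ (hs.liftVar _))
  | tfn _ _ ih₁ ih₂ =>
    simp only [Ty.sub, Shape.sub, CaptureSet.rename_empty] at ih₁ ⊢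
    exact .tfn (ih₁ hs) (ih₂ (hs.liftTVar _))
  | capt hC _ ih =>
    simp only [Ty.sub, CaptureSet.rename_empty] at ih ⊢
    exact .capt (hC.sub hs) (ih hs)
  | boxed _ ih =>
    simp only [Ty.sub, Shape.sub, CaptureSet.rename_empty]
    exact .boxed (ih hs)

theorem Ren.subst {f g : ℕ → ℕ} {Γ Γ' : Ctx} (h : Ren f g Γ Γ') :
    Subst f (fun X => .tvar (g X)) Γ Γ' where
  var hx := by
    have h' := h.var hx
    simp only [Ty.rename] at h'
    refine ⟨_, _, h', .sc_var h' (.refl _ _), ?_⟩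
    rw [Shape.rename_eq_sub]
    exact .refl
  tvar hX := by
    have h' := h.tvar hX
    refine ⟨.tvar h', ?_⟩
    rw [← Shape.rename_eq_sub]
    exact .tvar h'

theorem Subst.refl (Γ : Ctx) : Subst id .tvar Γ Γ :=
  Ren.subst (g := id) ⟨fun h => by rwa [Ty.rename_id], fun h => by rwa [Shape.rename_id]⟩

theorem liftSubstVar_id : liftSubstVar .tvar = .tvar := liftSubstVar_tvar id

theorem liftSubstTVar_id : liftSubstTVar .tvar = .tvar := by
  have h := liftSubstTVar_tvar id
  rwa [lift_id] at h

/-! ## Inversion of subtyping -/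

theorem Subtyp.capt_inv {Γ : Ctx} {T U : Ty} (h : Subtyp Γ T U) :
    ∀ {C D S R}, T = .capt C S → U = .capt D R → Subcapt Γ C D ∧ Subtyp Γ S.toTy R.toTy := by
  induction h with
  | refl =>
    rintro C D S R rfl e
    cases e
    exact ⟨.refl _ _, .refl⟩
  | @trans _ _ T₂ _ _ _ ih₁ ih₂ =>
    rintro C D S R rfl rfl
    obtain ⟨E, Q⟩ := T₂
    obtain ⟨a, b⟩ := ih₁ rfl rfl
    obtain ⟨c, d⟩ := ih₂ rfl rfl
    exact ⟨a.trans c, b.trans d⟩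
  | capt hC hS _ =>
    intro C D S R e e'
    cases e
    cases e'
    exact ⟨hC, hS⟩
  | tvar h => intro C D S R e e'; cases e; cases e'; exact ⟨.refl _ _, .tvar h⟩
  | top => intro C D S R e e'; cases e; cases e'; exact ⟨.refl _ _, .top⟩
  | fn h h' _ _ => intro C D S R e e'; cases e; cases e'; exact ⟨.refl _ _, .fn h h'⟩
  | tfn h h' _ _ => intro C D S R e e'; cases e; cases e'; exact ⟨.refl _ _, .tfn h h'⟩
  | boxed h _ => intro C D S R e e'; cases e; cases e'; exact ⟨.refl _ _, .boxed h⟩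

theorem Subtyp.capt_iff {Γ : Ctx} {C D : CaptureSet} {S R : Shape} :
    Subtyp Γ (.capt C S) (.capt D R) ↔ Subcapt Γ C D ∧ Subtyp Γ S.toTy R.toTy :=
  ⟨fun h => h.capt_inv rfl rfl, fun h => .capt h.1 h.2⟩

theorem Subtyp.narrowVar {Γ : Ctx} {U U' T T' : Ty} (hU : Subtyp Γ U' U)
    (h : Subtyp (Γ.var U) T T') : Subtyp (Γ.var U') T T' := by
  obtain ⟨C, S⟩ := U
  obtain ⟨D, R⟩ := U'
  obtain ⟨hC, hS⟩ := Subtyp.capt_iff.1 hU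
  have hs := (Subst.refl Γ).narrowVar (C := C) (S := S) (by rwa [CaptureSet.rename_id])
    (by rwa [Shape.sub_tvar])
  have := h.sub hs
  rwa [lift_id, liftSubstVar_id, Ty.sub_tvar, Ty.sub_tvar] at this

theorem Subtyp.narrowTVar {Γ : Ctx} {S R : Shape} {T T' : Ty} (hS : Subtyp Γ R.toTy S.toTy)
    (h : Subtyp (Γ.tvar S) T T') : Subtyp (Γ.tvar R) T T' := by
  have hs := (Subst.refl Γ).narrowTVar (S := S) (by rwa [Shape.sub_tvar])
  have := h.sub hs
  rwa [liftSubstTVar_id, Ty.sub_tvar, Ty.sub_tvar] at this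

theorem Subtyp.of_top {Γ : Ctx} {T U : Ty} (h : Subtyp Γ T U) :
    ∀ {C}, T = .capt C .top → ∃ D, U = .capt D .top := by
  induction h with
  | refl => exact fun e => ⟨_, e⟩
  | trans _ _ ih₁ ih₂ =>
    intro C e
    obtain ⟨D, rfl⟩ := ih₁ e
    exact ih₂ rfl
  | capt _ _ ih =>
    intro C e
    cases e
    obtain ⟨D, e⟩ := ih rfl
    cases e
    exact ⟨_, rfl⟩
  | top => exact fun _ => ⟨_, rfl⟩
  | tvar | fn | tfn | boxed => intro C e; cases e

/-- The supertypes of a function type. -/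
theorem Subtyp.of_all {Γ : Ctx} {T U : Ty} (h : Subtyp Γ T U) :
    ∀ {C U₁ T₁}, T = .capt C (.all U₁ T₁) → ∃ D, U = .capt D .top ∨
      ∃ U₂ T₂, U = .capt D (.all U₂ T₂) ∧ Subtyp Γ U₂ U₁ ∧ Subtyp (Γ.var U₂) T₁ T₂ := by
  induction h with
  | refl => rintro C U₁ T₁ rfl; exact ⟨_, .inr ⟨_, _, rfl, .refl, .refl⟩⟩
  | trans _ h ih₁ ih₂ =>
    intro C U₁ T₁ e
    obtain ⟨D, rfl | ⟨U₂, T₂, rfl, a, b⟩⟩ := ih₁ e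
    · obtain ⟨E, e⟩ := h.of_top rfl
      exact ⟨E, .inl e⟩
    · obtain ⟨E, rfl | ⟨U₃, T₃, rfl, c, d⟩⟩ := ih₂ rfl
      · exact ⟨E, .inl rfl⟩
      · exact ⟨E, .inr ⟨U₃, T₃, rfl, c.trans a, (c.narrowVar b).trans d⟩⟩
  | tvar | tfn | boxed => intro C U₁ T₁ e; cases e
  | top => intro C U₁ T₁ e; exact ⟨_, .inl rfl⟩
  | fn h h' _ _ => intro C U₁ T₁ e; cases e; exact ⟨_, .inr ⟨_, _, rfl, h, h'⟩⟩
  | capt _ _ ih =>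
    intro C U₁ T₁ e
    cases e
    obtain ⟨E, e | ⟨U₂, T₂, e, c, d⟩⟩ := ih rfl
    · cases e; exact ⟨_, .inl rfl⟩
    · cases e; exact ⟨_, .inr ⟨_, _, rfl, c, d⟩⟩

/-- The supertypes of a type function type. -/
theorem Subtyp.of_tall {Γ : Ctx} {T U : Ty} (h : Subtyp Γ T U) :
    ∀ {C S₁ T₁}, T = .capt C (.tall S₁ T₁) → ∃ D, U = .capt D .top ∨
      ∃ S₂ T₂, U = .capt D (.tall S₂ T₂) ∧ Subtyp Γ S₂.toTy S₁.toTy ∧ Subtyp (Γ.tvar S₂) T₁ T₂ := by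
  induction h with
  | refl => rintro C S₁ T₁ rfl; exact ⟨_, .inr ⟨_, _, rfl, .refl, .refl⟩⟩
  | trans _ h ih₁ ih₂ =>
    intro C S₁ T₁ e
    obtain ⟨D, rfl | ⟨S₂, T₂, rfl, a, b⟩⟩ := ih₁ e
    · obtain ⟨E, e⟩ := h.of_top rfl
      exact ⟨E, .inl e⟩
    · obtain ⟨E, rfl | ⟨S₃, T₃, rfl, c, d⟩⟩ := ih₂ rfl
      · exact ⟨E, .inl rfl⟩
      · exact ⟨E, .inr ⟨S₃, T₃, rfl, c.trans a, (c.narrowTVar b).trans d⟩⟩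
  | tvar | fn | boxed => intro C S₁ T₁ e; cases e
  | top => intro C S₁ T₁ e; exact ⟨_, .inl rfl⟩
  | tfn h h' _ _ => intro C S₁ T₁ e; cases e; exact ⟨_, .inr ⟨_, _, rfl, h, h'⟩⟩
  | capt _ _ ih =>
    intro C S₁ T₁ e
    cases e
    obtain ⟨E, e | ⟨S₂, T₂, e, c, d⟩⟩ := ih rfl
    · cases e; exact ⟨_, .inl rfl⟩
    · cases e; exact ⟨_, .inr ⟨_, _, rfl, c, d⟩⟩

/-- The supertypes of a boxed type. -/
theorem Subtyp.of_box {Γ : Ctx} {T U : Ty} (h : Subtyp Γ T U) :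
    ∀ {C T₁}, T = .capt C (.box T₁) → ∃ D, U = .capt D .top ∨
      ∃ T₂, U = .capt D (.box T₂) ∧ Subtyp Γ T₁ T₂ := by
  induction h with
  | refl => rintro C T₁ rfl; exact ⟨_, .inr ⟨_, rfl, .refl⟩⟩
  | trans _ h ih₁ ih₂ =>
    intro C T₁ e
    obtain ⟨D, rfl | ⟨T₂, rfl, a⟩⟩ := ih₁ e
    · obtain ⟨E, e⟩ := h.of_top rfl
      exact ⟨E, .inl e⟩
    · obtain ⟨E, rfl | ⟨T₃, rfl, c⟩⟩ := ih₂ rfl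
      · exact ⟨E, .inl rfl⟩
      · exact ⟨E, .inr ⟨T₃, rfl, a.trans c⟩⟩
  | tvar | fn | tfn => intro C T₁ e; cases e
  | top => intro C T₁ e; exact ⟨_, .inl rfl⟩
  | boxed h _ => intro C T₁ e; cases e; exact ⟨_, .inr ⟨_, rfl, h⟩⟩
  | capt _ _ ih =>
    intro C T₁ e
    cases e
    obtain ⟨E, e | ⟨T₂, e, c⟩⟩ := ih rfl
    · cases e; exact ⟨_, .inl rfl⟩
    · cases e; exact ⟨_, .inr ⟨_, rfl, c⟩⟩


/-! ## Regularity of typing -/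

theorem HasType.var_inv {Γ : Ctx} {t : Term} {T : Ty} (h : HasType Γ t T) :
    ∀ {y C S}, t = .var y → T = .capt C S → ∃ C' S', Γ.HasVar y (.capt C' S') ∧
      Subcapt Γ {.var y} C ∧ Subtyp Γ S'.toTy S.toTy := by
  induction h with
  | var hx =>
    intro y C S e e'
    cases e
    cases e'
    exact ⟨_, _, hx, .refl _ _, .refl⟩
  | @sub _ _ T _ _ hTU _ ih =>
    rintro y C S rfl rfl
    obtain ⟨D, R⟩ := T
    obtain ⟨C', S', hx, hC, hS⟩ := ih rfl rfl
    obtain ⟨a, b⟩ := Subtyp.capt_iff.1 hTU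
    exact ⟨C', S', hx, hC.trans a, hS.trans b⟩
  | abs | tabs | app | tapp | box | unbox | letIn => intro y C S e; cases e

theorem CaptureSet.unbind_subset {Γ : Ctx} {U : Ty} {C : CaptureSet}
    (h : (C : Set Cap) ⊆ (Γ.var U).dom ∪ {Cap.star}) :
    (CaptureSet.unbind C : Set Cap) ⊆ Γ.dom ∪ {Cap.star} := by
  rintro (_ | x) hx
  · exact Or.inr rfl
  · rcases h (Finset.mem_coe.2 (CaptureSet.mem_unbind_var.1 (Finset.mem_coe.1 hx))) with h' | h'
    · exact Or.inl (Ctx.succ_mem_dom_var.1 h')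
    · cases h'

theorem HasType.var_mem_dom {Γ : Ctx} {x : ℕ} {T : Ty} (h : HasType Γ (.var x) T) :
    Cap.var x ∈ Γ.dom := by
  obtain ⟨C, S⟩ := T
  obtain ⟨_, _, hx, -⟩ := h.var_inv rfl rfl
  exact Ctx.var_mem_dom.2 ⟨_, hx⟩

theorem singleton_var_subset {Γ : Ctx} {x : ℕ} (h : Cap.var x ∈ Γ.dom) :
    (({.var x} : CaptureSet) : Set Cap) ⊆ Γ.dom ∪ {Cap.star} := by
  intro c hc
  rw [Finset.mem_coe, Finset.mem_singleton] at hc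
  rw [hc]
  exact Or.inl h

/-- Types of terms are well-formed, and captured variables are bound. -/
theorem HasType.regular {Γ : Ctx} {t : Term} {T : Ty} (h : HasType Γ t T) (hΓ : Γ.WF) :
    Ty.WF Γ T ∧ (t.cv : Set Cap) ⊆ Γ.dom ∪ {Cap.star} := by
  induction h with
  | var hx =>
    have hd := singleton_var_subset (Ctx.var_mem_dom.2 ⟨_, hx⟩)
    cases hΓ.hasVar hx with
    | capt hS _ => exact ⟨.capt hS hd, hd⟩
  | sub _ _ hU ih => exact ⟨hU, (ih hΓ).2⟩
  | abs _ hU ih =>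
    obtain ⟨hT, ht⟩ := ih (hΓ.var hU)
    have hd := CaptureSet.unbind_subset ht
    exact ⟨.capt (.all hU hT) hd, hd⟩
  | tabs _ hS ih =>
    obtain ⟨hT, ht⟩ := ih (hΓ.tvar hS)
    rw [Ctx.dom_tvar] at ht
    exact ⟨.capt (.tall hS hT) ht, ht⟩
  | app hx hy ihx ihy =>
    have hd := (ihx hΓ).2
    have hd' := (ihy hΓ).2
    cases (ihx hΓ).1 with
    | capt hS _ =>
      cases hS with
      | all hU hT =>
        refine ⟨hT.inst hy.var_mem_dom, ?_⟩
        intro c hc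
        rw [Term.cv, Finset.mem_coe, Finset.mem_insert, Finset.mem_singleton] at hc
        rcases hc with rfl | rfl
        · exact Or.inl hx.var_mem_dom
        · exact Or.inl hy.var_mem_dom
  | tapp hx ih =>
    cases (ih hΓ).1 with
    | capt hS _ =>
      cases hS with
      | tall hS hT => exact ⟨hT.tinst hS, singleton_var_subset hx.var_mem_dom⟩
  | box hx hC ih =>
    refine ⟨.capt (.box (ih hΓ).1) ?_, ?_⟩ <;> intro c hc <;> exact absurd hc (by simp [Term.cv])
  | unbox hx hC ih =>
    cases (ih hΓ).1 with
    | capt hS _ =>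
      cases hS with
      | box hT =>
        refine ⟨hT, ?_⟩
        rw [Term.cv, Finset.coe_union]
        exact Set.union_subset (hC.trans Set.subset_union_left)
          (singleton_var_subset hx.var_mem_dom)
  | letIn _ _ ihs iht =>
    obtain ⟨hT, hs⟩ := ihs hΓ
    obtain ⟨hU, ht⟩ := iht (hΓ.var hT)
    refine ⟨hU.of_shiftVar, ?_⟩
    rw [Term.cv]
    split_ifs
    · exact CaptureSet.unbind_subset ht
    · rw [Finset.coe_union]
      exact Set.union_subset hs (CaptureSet.unbind_subset ht)

theorem HasType.wf {Γ : Ctx} {t : Term} {T : Ty} (h : HasType Γ t T) (hΓ : Γ.WF) : Ty.WF Γ T :=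
  (h.regular hΓ).1

/-! ## Typing under substitution -/

theorem HasType.subst {Γ Γ' : Ctx} {t : Term} {T : Ty} {f : ℕ → ℕ} {τ : ℕ → Shape}
    (h : HasType Γ t T) (hΓ : Γ.WF) (hs : Subst f τ Γ Γ') :
    HasType Γ' (t.sub f τ) (T.sub f τ) := by
  induction h generalizing f τ Γ' with
  | var hx =>
    obtain ⟨C', S', hx', hC, hS⟩ := hs.var hx
    have hwf := ((HasType.var hx).wf hΓ).sub _ hs.mapsDom hs.mapsTDom
    simp only [Ty.sub, CaptureSet.rename_singleton, Cap.rename] at hwf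
    simp only [Term.sub, Ty.sub, CaptureSet.rename_singleton, Cap.rename]
    exact .sub (.var hx') (.capt (.refl _ _) hS) hwf
  | sub _ hTU hU ih =>
    exact .sub (ih hΓ hs) (hTU.sub hs) (hU.sub _ hs.mapsDom hs.mapsTDom)
  | abs _ hU ih =>
    have := HasType.abs (ih (hΓ.var hU) (hs.liftVar _)) (hU.sub _ hs.mapsDom hs.mapsTDom)
    rw [Term.cv_sub, CaptureSet.unbind_rename_lift] at this
    simpa only [Term.sub, Ty.sub, Shape.sub] using this
  | tabs _ hS ih =>
    have := HasType.tabs (ih (hΓ.tvar hS) (hs.liftTVar _)) (hS.sub _ hs.mapsDom hs.mapsTDom)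
    rw [Term.cv_sub] at this
    simpa only [Term.sub, Ty.sub, Shape.sub] using this
  | app _ _ ihx ihy =>
    have hx := ihx hΓ hs
    simp only [Term.sub, Ty.sub, Shape.sub] at hx
    rw [Ty.inst_sub]
    exact .app hx (ihy hΓ hs)
  | tapp _ ih =>
    have hx := ih hΓ hs
    simp only [Term.sub, Ty.sub, Shape.sub] at hx
    rw [Ty.tinst_sub]
    exact .tapp hx
  | box _ hC ih =>
    have := HasType.box (ih hΓ hs) (hs.mapsDom.rename_subset hC)
    simpa only [Term.sub, Ty.sub, Shape.sub, CaptureSet.rename_empty] using this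
  | unbox _ hC ih =>
    have hx := ih hΓ hs
    simp only [Term.sub, Ty.sub, Shape.sub, CaptureSet.rename_empty] at hx
    exact .unbox hx (hs.mapsDom.rename_subset hC)
  | letIn hst _ ihs iht =>
    have := iht (hΓ.var (hst.wf hΓ)) (hs.liftVar _)
    rw [Ty.sub_shiftVar] at this
    exact .letIn (ihs hΓ hs) this

theorem HasType.rename {Γ Γ' : Ctx} {t : Term} {T : Ty} {f g : ℕ → ℕ} (h : HasType Γ t T)
    (hΓ : Γ.WF) (hr : Ren f g Γ Γ') : HasType Γ' (t.rename f g) (T.rename f g) := by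
  rw [Term.rename_eq_sub, Ty.rename_eq_sub]
  exact h.subst hΓ hr.subst

theorem Term.sub_tvar (t : Term) : t.sub id .tvar = t := by
  induction t <;>
    simp_all [Term.sub, lift_id, liftSubstVar_id, liftSubstTVar_id, Ty.sub_tvar, Shape.sub_tvar,
      CaptureSet.rename_id]

theorem HasType.narrowVar {Γ : Ctx} {U U' T : Ty} {t : Term} (h : HasType (Γ.var U) t T)
    (hΓ : (Γ.var U).WF) (hU : Subtyp Γ U' U) : HasType (Γ.var U') t T := by
  obtain ⟨C, S⟩ := U
  obtain ⟨D, R⟩ := U'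
  obtain ⟨hC, hS⟩ := Subtyp.capt_iff.1 hU
  have := h.subst hΓ ((Subst.refl Γ).narrowVar (C := C) (S := S)
    (by rwa [CaptureSet.rename_id]) (by rwa [Shape.sub_tvar]))
  rwa [lift_id, liftSubstVar_id, Ty.sub_tvar, Term.sub_tvar] at this

theorem HasType.narrowTVar {Γ : Ctx} {S R : Shape} {T : Ty} {t : Term}
    (h : HasType (Γ.tvar S) t T) (hΓ : (Γ.tvar S).WF) (hS : Subtyp Γ R.toTy S.toTy) :
    HasType (Γ.tvar R) t T := by
  have := h.subst hΓ ((Subst.refl Γ).narrowTVar (S := S) (by rwa [Shape.sub_tvar]))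
  rwa [liftSubstTVar_id, Ty.sub_tvar, Term.sub_tvar] at this

theorem Subst.instVar {Γ : Ctx} {U : Ty} {y : ℕ} (h : HasType Γ (.var y) U) :
    Subst (instVar y) .tvar (Γ.var U) Γ where
  var := by
    have key : ∀ {x T}, (Γ.var U).HasVar x T → ∀ {C S}, T = .capt C S →
        ∃ C' S', Γ.HasVar (CC.instVar y x) (.capt C' S') ∧
        Subcapt Γ {.var (CC.instVar y x)} (CaptureSet.rename (CC.instVar y) C) ∧
        Subtyp Γ S'.toTy (S.sub (CC.instVar y) .tvar).toTy := by
      intro x T hx C S e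
      have e' := congrArg (Ty.sub (CC.instVar y) .tvar) e
      cases hx with
      | here =>
        rw [Ty.shiftVar_sub_instVar, Ty.sub] at e'
        exact h.var_inv rfl e'
      | @var _ x T _ hx =>
        rw [Ty.shiftVar_sub_instVar, Ty.sub] at e'
        subst e'
        exact ⟨_, _, hx, .sc_var hx (.refl _ _), .refl⟩
    exact fun {_ _ _} hx => key hx rfl
  tvar hX := by
    cases hX with
    | var hX =>
      rw [Shape.shiftVar_sub_instVar]
      exact ⟨.tvar hX, .tvar hX⟩

theorem Subst.instTVar {Γ : Ctx} {S : Shape} (h : Shape.WF Γ S) :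
    Subst id (instTVar S) (Γ.tvar S) Γ where
  var := by
    have key : ∀ {x T}, (Γ.tvar S).HasVar x T → ∀ {C R}, T = .capt C R →
        ∃ C' R', Γ.HasVar x (.capt C' R') ∧ Subcapt Γ {.var x} (CaptureSet.rename id C) ∧
        Subtyp Γ R'.toTy (R.sub id (CC.instTVar S)).toTy := by
      intro x T hx C R e
      have e' := congrArg (Ty.sub id (CC.instTVar S)) e
      cases hx with
      | tvar hx =>
        rw [Ty.shiftTVar_sub_instTVar, Ty.sub] at e'
        subst e'
        exact ⟨_, _, hx, .sc_var hx (.refl _ _), .refl⟩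
    exact fun {_ _ _} hx => key hx rfl
  tvar hX := by
    cases hX with
    | here =>
      rw [Shape.shiftTVar_sub_instTVar]
      exact ⟨h, .refl⟩
    | tvar hX =>
      rw [Shape.shiftTVar_sub_instTVar]
      exact ⟨.tvar hX, .tvar hX⟩

theorem HasType.inst {Γ : Ctx} {U T : Ty} {t : Term} {y : ℕ} (h : HasType (Γ.var U) t T)
    (hΓ : Γ.WF) (hy : HasType Γ (.var y) U) : HasType Γ (t.inst y) (T.inst y) := by
  rw [Term.inst_eq_sub, Ty.inst_eq_sub]
  exact h.subst (hΓ.var (hy.wf hΓ)) (.instVar hy)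

theorem HasType.tinst {Γ : Ctx} {S : Shape} {T : Ty} {t : Term} (h : HasType (Γ.tvar S) t T)
    (hΓ : Γ.WF) (hS : Shape.WF Γ S) : HasType Γ (t.tinst S) (T.tinst S) := by
  rw [Term.tinst_eq_sub, Ty.tinst_eq_sub]
  exact h.subst (hΓ.tvar hS) (.instTVar hS)

/-! ## Inversion of typing -/

theorem HasType.abs_inv {Γ : Ctx} {t : Term} {T : Ty} (h : HasType Γ t T) :
    ∀ {U b}, t = .abs U b → ∃ C T', HasType (Γ.var U) b T' ∧ Ty.WF Γ U ∧
      Subtyp Γ (.capt C (.all U T')) T := by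
  induction h with
  | abs hb hU _ => intro U b e; cases e; exact ⟨_, _, hb, hU, .refl⟩
  | sub _ hTU _ ih =>
    intro U b e
    obtain ⟨C, T', hb, hU, h⟩ := ih e
    exact ⟨C, T', hb, hU, h.trans hTU⟩
  | var | tabs | app | tapp | box | unbox | letIn => intro U b e; cases e

theorem HasType.tabs_inv {Γ : Ctx} {t : Term} {T : Ty} (h : HasType Γ t T) :
    ∀ {S b}, t = .tabs S b → ∃ C T', HasType (Γ.tvar S) b T' ∧ Shape.WF Γ S ∧
      Subtyp Γ (.capt C (.tall S T')) T := by
  induction h with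
  | tabs hb hS _ => intro S b e; cases e; exact ⟨_, _, hb, hS, .refl⟩
  | sub _ hTU _ ih =>
    intro S b e
    obtain ⟨C, T', hb, hS, h⟩ := ih e
    exact ⟨C, T', hb, hS, h.trans hTU⟩
  | var | abs | app | tapp | box | unbox | letIn => intro S b e; cases e

theorem HasType.box_inv {Γ : Ctx} {t : Term} {T : Ty} (h : HasType Γ t T) :
    ∀ {y}, t = .box y → ∃ U, HasType Γ (.var y) U ∧ Subtyp Γ (Shape.box U).toTy T := by
  induction h with
  | box hy _ _ => intro y e; cases e; exact ⟨_, hy, .refl⟩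
  | sub _ hTU _ ih =>
    intro y e
    obtain ⟨U, hy, h⟩ := ih e
    exact ⟨U, hy, h.trans hTU⟩
  | var | abs | tabs | app | tapp | unbox | letIn => intro y e; cases e

theorem HasType.app_inv {Γ : Ctx} {t : Term} {T : Ty} (h : HasType Γ t T) (hΓ : Γ.WF) :
    ∀ {x y}, t = .app x y → ∃ C U T', HasType Γ (.var x) (.capt C (.all U T')) ∧
      HasType Γ (.var y) U ∧ ∀ {s}, HasType Γ s (T'.inst y) → HasType Γ s T := by
  induction h with
  | app hx hy _ _ => intro x y e; cases e; exact ⟨_, _, _, hx, hy, id⟩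
  | sub _ hTU hU ih =>
    intro x y e
    obtain ⟨C, U, T', hx, hy, h⟩ := ih hΓ e
    exact ⟨C, U, T', hx, hy, fun hs => .sub (h hs) hTU hU⟩
  | var | abs | tabs | box | tapp | unbox | letIn => intro x y e; cases e

theorem HasType.tapp_inv {Γ : Ctx} {t : Term} {T : Ty} (h : HasType Γ t T) :
    ∀ {x S}, t = .tapp x S → ∃ C T', HasType Γ (.var x) (.capt C (.tall S T')) ∧
      ∀ {s}, HasType Γ s (T'.tinst S) → HasType Γ s T := by
  induction h with
  | tapp hx _ => intro x S e; cases e; exact ⟨_, _, hx, id⟩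
  | sub _ hTU hU ih =>
    intro x S e
    obtain ⟨C, T', hx, h⟩ := ih e
    exact ⟨C, T', hx, fun hs => .sub (h hs) hTU hU⟩
  | var | abs | tabs | box | app | unbox | letIn => intro x S e; cases e

theorem HasType.unbox_inv {Γ : Ctx} {t : Term} {T : Ty} (h : HasType Γ t T) :
    ∀ {C x}, t = .unbox C x → ∃ U, HasType Γ (.var x) (Shape.box U).toTy ∧
      ∀ {s}, HasType Γ s U → HasType Γ s T := by
  induction h with
  | unbox hx _ _ => intro C x e; cases e; exact ⟨_, hx, id⟩
  | sub _ hTU hU ih =>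
    intro C x e
    obtain ⟨U, hx, h⟩ := ih e
    exact ⟨U, hx, fun hs => .sub (h hs) hTU hU⟩
  | var | abs | tabs | box | app | tapp | letIn => intro C x e; cases e

theorem HasType.letIn_inv {Γ : Ctx} {t : Term} {T : Ty} (h : HasType Γ t T) :
    ∀ {s u}, t = .letIn s u → ∃ U, HasType Γ s U ∧ HasType (Γ.var U) u T.shiftVar := by
  induction h with
  | letIn hs hu _ _ => intro s u e; cases e; exact ⟨_, hs, hu⟩
  | sub _ hTU hU ih =>
    intro s u e
    obtain ⟨V, hs, hu⟩ := ih e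
    exact ⟨V, hs, .sub hu (hTU.shiftVar V) (hU.shiftVar V)⟩
  | var | abs | tabs | box | app | tapp | unbox => intro s u e; cases e

/-! ## Evaluation contexts -/

theorem HasType.ectx_inv {Γ : Ctx} {s : Term} : ∀ {e : ECtx} {T : Ty},
    HasType Γ (e.plug s) T →
    ∃ U, HasType Γ s U ∧ ∀ {s'}, HasType Γ s' U → HasType Γ (e.plug s') T
  | .hole, T, h => ⟨T, h, id⟩
  | .letIn e u, T, h => by
    obtain ⟨V, hs, hu⟩ := h.letIn_inv rfl
    obtain ⟨U, hs, hp⟩ := HasType.ectx_inv hs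
    exact ⟨U, hs, fun h => .letIn (hp h) hu⟩

theorem HasType.ectx_letIn_inv {Γ : Ctx} (hΓ : Γ.WF) {s u : Term} : ∀ {e : ECtx} {T : Ty},
    HasType Γ (e.plug (.letIn s u)) T →
    ∃ V, HasType Γ s V ∧ HasType (Γ.var V) (e.shiftVar.plug u) T.shiftVar
  | .hole, T, h => h.letIn_inv rfl
  | .letIn e w, T, h => by
    obtain ⟨U, hs, hw⟩ := h.letIn_inv rfl
    obtain ⟨V, hs', hp⟩ := HasType.ectx_letIn_inv hΓ hs
    refine ⟨V, hs', .letIn hp ?_⟩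
    have := hw.rename (hΓ.var (hs.wf hΓ)) ((Ren.shiftVar Γ V).liftVar U)
    rwa [Ty.shiftVar_rename] at this

/-! ## Store contexts -/

theorem add_length_comp_succ (U : Ty) (Δ : List Ty) :
    (· + Δ.length) ∘ Nat.succ = (· + (U :: Δ).length) := by
  funext i
  simp only [List.length_cons, Function.comp]
  omega

theorem Ctx.HasVar.append {Γ : Ctx} {x : ℕ} {T : Ty} (h : Γ.HasVar x T) (Δ : List Ty) :
    (Γ.append Δ).HasVar (x + Δ.length) (T.rename (· + Δ.length) id) := by
  induction Δ generalizing Γ x T with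
  | nil => exact (Ty.rename_id T).symm ▸ h
  | cons U Δ ih =>
    have := ih (Γ := Γ.var U) (.var h)
    rwa [Ty.shiftVar, Ty.rename_rename, add_length_comp_succ U, Nat.add_right_comm, Nat.add_assoc,
      ← List.length_cons (a := U)] at this

theorem Ctx.HasTVar.append {Γ : Ctx} {X : ℕ} {S : Shape} (h : Γ.HasTVar X S) (Δ : List Ty) :
    (Γ.append Δ).HasTVar X (S.rename (· + Δ.length) id) := by
  induction Δ generalizing Γ X S with
  | nil => exact (Shape.rename_id S).symm ▸ h
  | cons U Δ ih =>
    have := ih (Γ := Γ.var U) (.var h)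
    rwa [Shape.shiftVar, Shape.rename_rename, add_length_comp_succ U] at this

theorem Ren.append (Γ : Ctx) (Δ : List Ty) : Ren (· + Δ.length) id Γ (Γ.append Δ) :=
  ⟨fun h => h.append Δ, fun h => h.append Δ⟩

theorem Matches.wf {Γ : Ctx} {σ : Store} {Δ : List Ty} (h : Matches Γ σ Δ) (hΓ : Γ.WF) :
    (Γ.append Δ).WF := by
  induction h with
  | hole => exact hΓ
  | letIn _ hv ih => exact ih (hΓ.var (hv.wf hΓ))

theorem Matches.size_eq {Γ : Ctx} {σ : Store} {Δ : List Ty} (h : Matches Γ σ Δ) :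
    σ.size = Δ.length := by
  induction h with
  | hole => rfl
  | letIn _ _ ih => rw [Store.size, List.length_cons, ih]

/-- The value of a variable of the store has the type of the variable. -/
theorem Matches.lookup {Γ : Ctx} {σ : Store} {Δ : List Ty} (h : Matches Γ σ Δ) (hΓ : Γ.WF)
    {x : ℕ} {v : Term} (hx : σ.Lookup x v) :
    ∃ T, (Γ.append Δ).HasVar x T ∧ HasType (Γ.append Δ) v T := by
  induction h with
  | hole => cases hx
  | @letIn Γ w hw σ T Δ hm hv ih =>
    cases hx with
    | here =>
      rw [hm.size_eq]
      have h1 := (Ctx.HasVar.here (Γ := Γ) (T := T)).append Δ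
      rw [Ty.shiftVar, Ty.rename_rename, add_length_comp_succ T, Nat.zero_add] at h1
      exact ⟨_, h1, hv.rename hΓ (.append Γ (T :: Δ))⟩
    | there hx => exact ih (hΓ.var (hv.wf hΓ)) hx

/-- Composition of store contexts. -/
def Store.comp : Store → Store → Store
  | .hole, σ' => σ'
  | .letIn v hv σ, σ' => .letIn v hv (σ.comp σ')

theorem Store.plug_comp (σ σ' : Store) (t : Term) : (σ.comp σ').plug t = σ.plug (σ'.plug t) := by
  induction σ with
  | hole => rfl
  | letIn v hv σ ih => simp only [Store.comp, Store.plug, ih]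

theorem Store.plug_injective (σ : Store) {t t' : Term} (h : σ.plug t = σ.plug t') : t = t' := by
  induction σ with
  | hole => exact h
  | letIn v hv σ ih => exact ih (Term.letIn.inj h).2

theorem Ctx.append_append (Γ : Ctx) (Δ Δ' : List Ty) :
    (Γ.append Δ).append Δ' = Γ.append (Δ ++ Δ') := by
  induction Δ generalizing Γ with
  | nil => rfl
  | cons T Δ ih => exact ih _

theorem Matches.comp {Γ : Ctx} {σ σ' : Store} {Δ Δ' : List Ty} (h : Matches Γ σ Δ)
    (h' : Matches (Γ.append Δ) σ' Δ') : Matches Γ (σ.comp σ') (Δ ++ Δ') := by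
  induction h with
  | hole => exact h'
  | letIn _ hv ih => exact .letIn (ih h') hv

theorem HasType.store_inv {t : Term} : ∀ {σ : Store} {Γ : Ctx} {T : Ty},
    HasType Γ (σ.plug t) T → ∃ Δ U, Matches Γ σ Δ ∧ HasType (Γ.append Δ) t U ∧
      ∀ {t'}, HasType (Γ.append Δ) t' U → HasType Γ (σ.plug t') T
  | .hole, Γ, T, h => ⟨[], T, .hole, h, id⟩
  | .letIn v hv σ, Γ, T, h => by
    obtain ⟨V, hv', ht⟩ := h.letIn_inv rfl
    obtain ⟨Δ, U, hm, ht, hp⟩ := HasType.store_inv ht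
    exact ⟨V :: Δ, U, .letIn hm hv', ht, fun h => .letIn hv' (hp h)⟩

/-- A store context in front of a term that does not bind a value extends any other one. -/
theorem Store.eq_comp_of_plug_eq {r : Term}
    (hr : ∀ v u, r = .letIn v u → v.isValue = false) : ∀ {σ σ' : Store} {t : Term},
    σ.plug t = σ'.plug r → ∃ σ₁, σ' = σ.comp σ₁ ∧ t = σ₁.plug r
  | .hole, σ', _, h => ⟨σ', rfl, h⟩
  | .letIn v hv σ, .hole, t, h => absurd hv (by rw [hr v _ h.symm]; exact Bool.false_ne_true)
  | .letIn v hv σ, .letIn v' hv' σ', t, h => by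
    obtain ⟨rfl, h'⟩ := Term.letIn.inj h
    obtain ⟨σ₁, rfl, e⟩ := Store.eq_comp_of_plug_eq hr h'
    exact ⟨σ₁, rfl, e⟩

theorem ECtx.plug_isValue {r : Term} (hr : r.isValue = false) (e : ECtx) :
    (e.plug r).isValue = false := by
  cases e with
  | hole => exact hr
  | letIn e u => rfl

theorem ECtx.plug_eq_letIn {r : Term} (hr : r.isValue = false)
    (hl : ∀ v u, r = .letIn v u → v.isValue = false) {e : ECtx} {v u : Term}
    (h : e.plug r = .letIn v u) : v.isValue = false := by
  cases e with
  | hole => exact hl v u h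
  | letIn e w =>
    obtain ⟨rfl, _⟩ := Term.letIn.inj h
    exact ECtx.plug_isValue hr e

/-! ## Preservation -/

section Redex

variable {Γ : Ctx} {σ : Store} {Δ : List Ty}

/-- The value of a variable of the store, at any shape of that variable. -/
theorem Matches.lookup_subtyp (hm : Matches Γ σ Δ) (hΓ : Γ.WF) {x : ℕ} {v : Term}
    (hx : σ.Lookup x v) {C : CaptureSet} {S : Shape}
    (h : HasType (Γ.append Δ) (.var x) (.capt C S)) :
    ∃ D R, HasType (Γ.append Δ) v (.capt D R) ∧ Subtyp (Γ.append Δ) R.toTy S.toTy := by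
  obtain ⟨T, hT, hv⟩ := hm.lookup hΓ hx
  obtain ⟨D, R, hR, -, hRS⟩ := h.var_inv rfl rfl
  cases hT.unique hR
  exact ⟨D, R, hv, hRS⟩

theorem HasType.apply (hm : Matches Γ σ Δ) (hΓ : Γ.WF) {x y : ℕ} {U T : Ty} {t : Term}
    (hx : σ.Lookup x (.abs U t)) (h : HasType (Γ.append Δ) (.app x y) T) :
    HasType (Γ.append Δ) (t.inst y) T := by
  have hΓ' := hm.wf hΓ
  obtain ⟨C, U₂, T₂, hf, hy, hT⟩ := h.app_inv hΓ' rfl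
  obtain ⟨D, R, hv, hR⟩ := hm.lookup_subtyp hΓ hx hf
  obtain ⟨E, T₁, hb, hU, hs⟩ := hv.abs_inv rfl
  obtain ⟨-, hs⟩ := Subtyp.capt_iff.1 hs
  obtain ⟨F, e | ⟨U₃, T₃, e, h₁, h₂⟩⟩ := (hs.trans hR).of_all rfl
  · cases e
  · cases e
    cases hf.wf hΓ' with
    | capt hS _ =>
      cases hS with
      | all _ hT₂ =>
        exact hT (((hb.narrowVar (hΓ'.var hU) h₁).sub h₂ hT₂).inst hΓ' hy)

theorem HasType.tapply (hm : Matches Γ σ Δ) (hΓ : Γ.WF) {x : ℕ} {S S' : Shape} {T : Ty}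
    {t : Term} (hx : σ.Lookup x (.tabs S' t)) (h : HasType (Γ.append Δ) (.tapp x S) T) :
    HasType (Γ.append Δ) (t.tinst S) T := by
  have hΓ' := hm.wf hΓ
  obtain ⟨C, T₂, hf, hT⟩ := h.tapp_inv rfl
  obtain ⟨D, R, hv, hR⟩ := hm.lookup_subtyp hΓ hx hf
  obtain ⟨E, T₁, hb, hS', hs⟩ := hv.tabs_inv rfl
  obtain ⟨-, hs⟩ := Subtyp.capt_iff.1 hs
  obtain ⟨F, e | ⟨S₃, T₃, e, h₁, h₂⟩⟩ := (hs.trans hR).of_tall rfl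
  · cases e
  · cases e
    cases hf.wf hΓ' with
    | capt hS _ =>
      cases hS with
      | tall hS hT₂ =>
        exact hT (((hb.narrowTVar (hΓ'.tvar hS') h₁).sub h₂ hT₂).tinst hΓ' hS)

theorem HasType.open (hm : Matches Γ σ Δ) (hΓ : Γ.WF) {C : CaptureSet} {x y : ℕ} {T : Ty}
    (hx : σ.Lookup x (.box y)) (h : HasType (Γ.append Δ) (.unbox C x) T) :
    HasType (Γ.append Δ) (.var y) T := by
  obtain ⟨U, hb, hT⟩ := h.unbox_inv rfl
  obtain ⟨D, R, hv, hR⟩ := hm.lookup_subtyp hΓ hx hb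
  obtain ⟨V, hy, hs⟩ := hv.box_inv rfl
  obtain ⟨-, hs⟩ := Subtyp.capt_iff.1 hs
  obtain ⟨F, e | ⟨W, e, h₁⟩⟩ := (hs.trans hR).of_box rfl
  · cases e
  · cases e
    cases hb.wf (hm.wf hΓ) with
    | capt hS _ =>
      cases hS with
      | box hU => exact hT (hy.sub h₁ hU)

theorem HasType.letIn_var (hΓ : Γ.WF) {y : ℕ} {t : Term} {T : Ty}
    (h : HasType Γ (.letIn (.var y) t) T) : HasType Γ (t.inst y) T := by
  obtain ⟨U, hy, ht⟩ := h.letIn_inv rfl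
  have := ht.inst hΓ hy
  rwa [Ty.shiftVar_inst] at this

/-- If replacing `r` by `r'` preserves types in the scope of a store context extending `σ`, then
it preserves types in the scope of `σ`. -/
theorem HasType.of_plug_eq (hm : Matches Γ σ Δ) {σ' : Store} {t t' r r' : Term} {T : Ty}
    (ht : HasType (Γ.append Δ) t T) (hr : ∀ v u, r = .letIn v u → v.isValue = false)
    (h : σ.plug t = σ'.plug r) (h' : σ.plug t' = σ'.plug r')
    (hred : ∀ {Δ' U}, Matches Γ σ' Δ' → HasType (Γ.append Δ') r U →
      HasType (Γ.append Δ') r' U) :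
    HasType (Γ.append Δ) t' T := by
  obtain ⟨σ₁, rfl, rfl⟩ := Store.eq_comp_of_plug_eq hr h
  rw [Store.plug_comp] at h'
  rw [σ.plug_injective h']
  obtain ⟨Δ₁, U, hm₁, hr, hp⟩ := ht.store_inv
  refine hp ?_
  rw [Ctx.append_append] at hr ⊢
  exact hred (hm.comp hm₁) hr

end Redex

end CC

theorem mainTheorem1 (Γ : CC.Ctx) (σ : CC.Store) (Δ : List CC.Ty) (t t' : CC.Term) (T : CC.Ty)
    (hΓ : Γ.WF)
    (hσ : CC.Matches Γ σ Δ)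
    (ht : CC.HasType (Γ.append Δ) t T)
    (hstep : CC.Step (σ.plug t) (σ.plug t')) :
    CC.HasType (Γ.append Δ) t' T := by
  generalize h : σ.plug t = p at hstep
  generalize h' : σ.plug t' = q at hstep
  rcases hstep with hx | hx | hx | _ | @⟨σ', e, v, u, hv, he⟩
  · refine ht.of_plug_eq hσ (fun _ _ => CC.ECtx.plug_eq_letIn rfl (by rintro _ _ ⟨⟩)) h h' ?_
    intro Δ' U hm hr
    obtain ⟨V, hs, hp⟩ := hr.ectx_inv
    exact hp (hs.apply hm hΓ hx)
  · refine ht.of_plug_eq hσ (fun _ _ => CC.ECtx.plug_eq_letIn rfl (by rintro _ _ ⟨⟩)) h h' ?_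
    intro Δ' U hm hr
    obtain ⟨V, hs, hp⟩ := hr.ectx_inv
    exact hp (hs.tapply hm hΓ hx)
  · refine ht.of_plug_eq hσ (fun _ _ => CC.ECtx.plug_eq_letIn rfl (by rintro _ _ ⟨⟩)) h h' ?_
    intro Δ' U hm hr
    obtain ⟨V, hs, hp⟩ := hr.ectx_inv
    exact hp (hs.open hm hΓ hx)
  · refine ht.of_plug_eq hσ (fun _ _ => CC.ECtx.plug_eq_letIn rfl ?_) h h' ?_
    · rintro _ _ e
      cases e
      rfl
    · intro Δ' U hm hr
      obtain ⟨V, hs, hp⟩ := hr.ectx_inv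
      exact hp (hs.letIn_var (hm.wf hΓ))
  · refine ht.of_plug_eq hσ ?_ h h' ?_
    · intro w b e'
      cases e with
      | hole => exact absurd rfl he
      | letIn e c =>
        obtain ⟨rfl, _⟩ := CC.Term.letIn.inj e'
        exact CC.ECtx.plug_isValue rfl e
    · intro Δ' U hm hr
      obtain ⟨V, hs, hp⟩ := hr.ectx_letIn_inv (hm.wf hΓ)
      exact .letIn hs hp
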